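/- Call a function $f:\mathbb{R}\to\mathbb{R}$ \emph{positive positive definite} if it is continuous, $f\ge 0$, and $\sum_{j,k=1}^n c_j\overline{c_k}f(x_j-x_k)\ge 0$ for all $n$, all $x_1,\dots,x_n\in\mathbb{R}$ and all $c_1,\dots,c_n\in\mathbb{C}$. Let $\Omega^+$ be the convex cone of these functions. An element $f\in\Omega^+$ is an \emph{extremal ray generator} of $\Omega^+$ if $\Omega^+\cap(f-\Omega^+)=\{tf:0\le t\le 1\}$. A \emph{Hermite function} of degree $N$ is a function $P(x)e^{-\lambda x^2}$ with $\lambda>0$ and $P$ a real polynomial of degree $N$. Let $H_0(x)=1$, $H_2(x)=4\pi x^2-1$, $H_4(x)=(4\pi x^2)^2-6(4\pi x^2)+3$ and, for $a,b\in\mathbb{R}$, $$f_{a,b}(x)=\bigl(H_0(x)+2aH_2(x)+bH_4(x)\bigr)e^{-\pi x^2}.$$ Let $\mathcal{D}\subset\mathbb{R}^2$ be the set of all $(a,b)$ such that either $a\ge 0$ and $(a+2b)^2+2(b-\tfrac14)^2\le\tfrac18$, or $a\le 0$ and $(-a+2b)^2+2(b-\tfrac14)^2\le\tfrac18$. \textbf{Proposition.}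 (1) $\mathcal{D}$ is the intersection of the ellipse $(a+2b)^2+2(b-\frac14)^2\le\frac18$ with its mirror image under $(a,b)\mapsto(-a,b)$; equivalently, $\mathcal{D}=\{(a,b):(|a|+2b)^2+2(b-\frac14)^2\le\frac18\}$. (2) For all $a,b\in\mathbb{R}$, $f_{a,b}$ is positive positive definite if and only if $(a,b)\in\mathcal{D}$. (3) Let $\lambda>0$. The positive positive definite functions of the form $P(x)e^{-\lambda x^2}$ with $P$ a nonzero real polynomial of degree at most $4$ are exactly the functions $x\mapsto c\,f_{a,b}\bigl(\sqrt{\lambda/\pi}\,x\bigr)$ with $c>0$ and $(a,b)\in\mathcal{D}$. Those with $P$ of degree exactly $4$ are exactly the ones with $c>0$ and $(a,b)\in\mathcal{D}\setminus\{(0,0)\}$. (4) For all $a,b\in\mathbb{R}$, $f_{a,b}$ is an extremal ray generator of $\Omega^+$ if and only if $(a,b)$ belongs to the boundary $\partial\mathcal{D}$ of $\mathcal{D}$. -/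

import Mathlib

/-- A function `f : ℝ → ℂ` is positive definite if it is continuous and
`∑ j k, c_j * conj c_k * f (x_j - x_k) ≥ 0` (that is, real and nonnegative) for all real points
`x_j` and complex coefficients `c_j`. -/
def IsPositiveDefinite (f : ℝ → ℂ) : Prop :=
  Continuous f ∧ ∀ (n : ℕ) (x : Fin n → ℝ) (c : Fin n → ℂ),
    (∑ j, ∑ k, c j * (starRingEnd ℂ) (c k) * f (x j - x k)).im = 0 ∧
    0 ≤ (∑ j, ∑ k, c j * (starRingEnd ℂ) (c k) * f (x j - x k)).re

/-- The cone `Ω⁺` of positive positive definite functions on the line: the (continuous) positive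
definite functions with nonnegative real values. They are automatically even, see
`PosPosDef.even`. -/
def PosPosDef : Set (ℝ → ℝ) :=
  {f | IsPositiveDefinite (fun x => (f x : ℂ)) ∧ ∀ x, 0 ≤ f x}

theorem PosPosDef.even {f : ℝ → ℝ} (hf : f ∈ PosPosDef) : f.Even := by
  intro t
  have h := (hf.1.2 2 ![t, 0] ![1, Complex.I]).1
  simp [Fin.sum_univ_two] at h
  linarith

/-- The interval `I(f) = Ω⁺ ∩ (f - Ω⁺)` generated by `f`. -/
def ppdInterval (f : ℝ → ℝ) : Set (ℝ → ℝ) :=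
  {g | g ∈ PosPosDef ∧ ∃ h ∈ PosPosDef, g = f - h}

/-- `f` is an extremal ray generator of `Ω⁺`: it lies in `Ω⁺` and
`I(f) = {t f : 0 ≤ t ≤ 1}`. -/
def IsExtremalRayGenerator (f : ℝ → ℝ) : Prop :=
  f ∈ PosPosDef ∧ ppdInterval f = {g | ∃ t : ℝ, 0 ≤ t ∧ t ≤ 1 ∧ g = t • f}

/-- The polynomial `H_k` with leading term `(2 √π x) ^ k`, normalised so that `H_k(x) e^{-π x²}`
is a multiple of `e^{π x²} ∂ᵏ e^{-2π x²}`: the probabilists' Hermite polynomial at `2 √π x`. -/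
noncomputable def hermiteH (k : ℕ) (x : ℝ) : ℝ :=
  Polynomial.aeval (2 * Real.sqrt Real.pi * x) (Polynomial.hermite k)

theorem hermiteH_zero (x : ℝ) : hermiteH 0 x = 1 := by
  simp [hermiteH]

theorem hermiteH_two (x : ℝ) : hermiteH 2 x = 4 * Real.pi * x ^ 2 - 1 := by
  have h : Real.sqrt Real.pi ^ 2 = Real.pi := Real.sq_sqrt Real.pi_pos.le
  simp [hermiteH, Polynomial.hermite_succ]
  linear_combination 4 * x ^ 2 * h

theorem hermiteH_four (x : ℝ) :
    hermiteH 4 x = (4 * Real.pi * x ^ 2) ^ 2 - 6 * (4 * Real.pi * x ^ 2) + 3 := by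
  have h : Real.sqrt Real.pi ^ 2 = Real.pi := Real.sq_sqrt Real.pi_pos.le
  simp [hermiteH, Polynomial.hermite_succ]
  linear_combination
    (16 * x ^ 4 * (Real.sqrt Real.pi ^ 2 + Real.pi) - 24 * x ^ 2) * h

/-- `f_{a,b}(x) = (H_0(x) + 2 a H_2(x) + b H_4(x)) e^{-π x²}`. -/
noncomputable def hermiteFab (a b : ℝ) (x : ℝ) : ℝ :=
  (hermiteH 0 x + 2 * a * hermiteH 2 x + b * hermiteH 4 x) * Real.exp (-Real.pi * x ^ 2)

/-- The Hermite functions `P(x) e^{-l x²}` with `P` a real polynomial of degree `N`. -/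
def hermiteFunctions (N : ℕ) (l : ℝ) : Set (ℝ → ℝ) :=
  {f | ∃ P : Polynomial ℝ, P.degree = N ∧ f = fun x => P.eval x * Real.exp (-l * x ^ 2)}

/-- The full ellipse `(a + 2b)² + 2 (b - 1/4)² ≤ 1/8`. -/
def ellipsePlus : Set (ℝ × ℝ) :=
  {p | (p.1 + 2 * p.2) ^ 2 + 2 * (p.2 - 1 / 4) ^ 2 ≤ 1 / 8}

/-- The mirror image of `ellipsePlus` under `(a, b) ↦ (-a, b)`. -/
def ellipseMinus : Set (ℝ × ℝ) :=
  {p | (-p.1, p.2) ∈ ellipsePlus}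

/-- The region `D`. -/
def regionD : Set (ℝ × ℝ) :=
  {p | (0 ≤ p.1 ∧ (p.1 + 2 * p.2) ^ 2 + 2 * (p.2 - 1 / 4) ^ 2 ≤ 1 / 8) ∨
    (p.1 ≤ 0 ∧ (-p.1 + 2 * p.2) ^ 2 + 2 * (p.2 - 1 / 4) ^ 2 ≤ 1 / 8)}

/-! The Gaussian `e^{-πx²}` is its own Fourier transform, and the transform multiplies `H₀, H₂, H₄`
(times the Gaussian) by `1, -1, 1`. It therefore acts on the family `c H₀ + 2 a H₂ + b H₄` as `a ↦
-a`. For an integrable function, positive definiteness amounts to nonnegativity of the Fourier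
transform. Membership in the cone thus says that two quadratics in `u = 4πx²`, exchanged by `a ↦
-a`, are nonnegative on `u ≥ 0`. Evaluating at a vertex gives `0 ≤ c` and `a² + 4|a|b + 6b² ≤ cb`
(`evenHermite_mem_posPosDef_iff`). At `c = 1` this is the intersection of the two mirror ellipses.

For extremality, the essential point is that everything below such a function in the order of the
cone stays in the same three-parameter family (`PosPosDef.eq_evenHermite_of_sub_mem`). If `g` and `f
- g` both lie in the cone, then `g ≤ f` and `ĝ ≤ f̂` pointwise. The first bound makes `ĝ` entire
with controlled growth, the second makes it a Gaussian times polynomial growth on the real line. A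
Phragmén–Lindelöf argument, as in Hardy's uncertainty principle, shows that `ĝ(z) e^{πz²}` is a
polynomial of degree at most four.

What remains is convex geometry in three dimensions. A boundary point of `D` lies on the boundary of
one of the two ellipses, and strict convexity of that ellipse forbids nontrivial decompositions
(`eq_mul_of_add_of_quadratic_le`). An interior point is a midpoint of two other points of `D`. -/

/-! ### Phragmén–Lindelöf and Hardy's theorem -/

open Complex in
/-- An entire function of growth `exp (a (re z) ^ 2)`, up to a polynomial factor, that grows
polynomially on the positive real half-line grows polynomially in the first quadrant. -/
theorem norm_le_polynomial_of_quadrant {F : ℂ → ℂ} (hF : Differentiable ℂ F) {a C : ℝ} {n : ℕ}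
    (ha : 0 < a) (hC : 0 ≤ C)
    (hexp : ∀ z : ℂ, ‖F z‖ ≤ C * (1 + ‖z‖) ^ n * Real.exp (a * z.re ^ 2))
    (hreal : ∀ x : ℝ, 0 ≤ x → ‖F x‖ ≤ C * (1 + ‖(x : ℂ)‖) ^ n)
    {z : ℂ} (hre : 0 ≤ z.re) (him : 0 ≤ z.im) :
    ‖F z‖ ≤ C * 2 ^ n * (1 + ‖z‖) ^ n := by
  -- On the right half-plane `1 + w` has no zero and is comparable to `1 + ‖w‖`, so division by `(1
  -- + w) ^ n` turns polynomial growth into boundedness and stays holomorphic.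
  have key : ∀ w : ℂ, 0 ≤ w.re → (1 + ‖w‖) ≤ 2 * ‖1 + w‖ := by
    intro w hw
    have h1 : ‖w‖ ^ 2 = w.re ^ 2 + w.im ^ 2 := by
      rw [← Complex.normSq_eq_norm_sq, Complex.normSq_apply]; ring
    have h2 : ‖1 + w‖ ^ 2 = (1 + w.re) ^ 2 + w.im ^ 2 := by
      rw [← Complex.normSq_eq_norm_sq, Complex.normSq_apply]; simp; ring
    have h3 := norm_nonneg w
    have h4 := norm_nonneg (1 + w)
    nlinarith [sq_nonneg (‖w‖ - 1)]
  have hmono : ∀ w : ℂ, 0 ≤ w.re → C * (1 + ‖w‖) ^ n ≤ C * 2 ^ n * ‖1 + w‖ ^ n := by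
    intro w hw
    rw [mul_assoc, ← mul_pow]
    gcongr
    exact key w hw
  have hone : ∀ w : ℂ, 0 ≤ w.re → 0 < ‖1 + w‖ := by
    intro w hw
    rw [norm_pos_iff]
    intro h
    have := congrArg Complex.re h
    simp at this
    linarith
  have hpow : (1 : ℝ) ≤ 2 ^ n := one_le_pow₀ (by norm_num)
  have hrelax : ∀ w : ℂ, C * (1 + ‖w‖) ^ n ≤ C * 2 ^ n * (1 + ‖w‖) ^ n := by
    intro w
    have : 0 ≤ C * (1 + ‖w‖) ^ n := by positivity
    nlinarith
  rcases him.eq_or_lt with h0 | him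
  · have hz : z = (z.re : ℂ) := Complex.ext rfl (by simp [← h0])
    rw [hz]
    exact (hreal _ hre).trans (hrelax _)
  rcases hre.eq_or_lt with h0 | hre
  · refine (hexp z).trans ?_
    rw [← h0]
    simpa using hrelax z
  have hz0 : z ≠ 0 := by rintro rfl; simp at him
  set ζ : ℂ := Complex.log z with hζ
  have hexpζ : Complex.exp ζ = z := Complex.exp_log hz0
  have hζim : ζ.im = Complex.arg z := Complex.log_im z
  have harg0 : 0 ≤ z.arg := Complex.arg_nonneg_iff.2 him.le
  have harg1 : z.arg < Real.pi / 2 := (abs_lt.1 (Complex.abs_arg_lt_pi_div_two_iff.2 (Or.inl hre))).2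
  have hre_exp : ∀ w : ℂ, 0 ≤ w.im → w.im < Real.pi / 2 → 0 ≤ (Complex.exp w).re := by
    intro w h1 h2
    rw [Complex.exp_re]
    have := Real.cos_nonneg_of_neg_pi_div_two_le_of_le (by linarith) h2.le
    positivity
  have hsq : ∀ w : ℂ, (I * Complex.exp w ^ 2).re
      = -(2 * (Complex.exp w).re * (Complex.exp w).im) := by
    intro w; simp [sq]; ring
  -- Growth of order 2 is critical for an angle `π / 2`, so Phragmén–Lindelöf is applied to sectors
  -- of angle `θ < π / 2`, straightened to strips by the logarithm; the exponent condition becomes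
  -- `2 < π / θ`. Afterwards `θ` tends to `π / 2`.
  have hsector : ∀ θ : ℝ, z.arg < θ → θ < Real.pi / 2 →
      ‖F z‖ ≤ C * 2 ^ n * ‖1 + z‖ ^ n
        * Real.exp (a / 2 * (Real.cos θ / Real.sin θ) * (2 * z.re * z.im)) := by
    intro θ h1 h2
    have hθ : 0 < θ := harg0.trans_lt h1
    have hsin : 0 < Real.sin θ := Real.sin_pos_of_pos_of_lt_pi hθ (by linarith [Real.pi_pos])
    have hcos : 0 < Real.cos θ := Real.cos_pos_of_mem_Ioo ⟨by linarith, h2⟩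
    -- `A` is chosen so that on the ray of argument `θ` the factor `exp(iAw²)`, of modulus `exp(-2A
    -- re(w) im(w))`, exactly cancels `exp(a re(w)²)`. On the real axis it has modulus 1, and `A`
    -- tends to 0 as `θ` tends to `π / 2`.
    set A : ℝ := a / 2 * (Real.cos θ / Real.sin θ) with hA
    have hA0 : 0 < A := by positivity
    let Φ : ℂ → ℂ := fun w =>
      F (Complex.exp w) / (1 + Complex.exp w) ^ n * Complex.exp (A * (I * Complex.exp w ^ 2))
    have hnorm : ∀ w, ‖Φ w‖ = ‖F (Complex.exp w)‖ / ‖1 + Complex.exp w‖ ^ n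
        * Real.exp (-(A * (2 * (Complex.exp w).re * (Complex.exp w).im))) := by
      intro w
      simp only [Φ, norm_mul, norm_div, norm_pow, Complex.norm_exp]
      rw [Complex.re_ofReal_mul, hsq]
      ring_nf
    have hclosure : closure (Complex.im ⁻¹' Set.Ioo 0 θ) ⊆ Complex.im ⁻¹' Set.Icc 0 θ :=
      closure_minimal (Set.preimage_mono Set.Ioo_subset_Icc_self)
        (isClosed_Icc.preimage Complex.continuous_im)
    have hd : DiffContOnCl ℂ Φ (Complex.im ⁻¹' Set.Ioo 0 θ) := by
      apply DifferentiableOn.diffContOnCl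
      intro w hw
      have hw' := hclosure hw
      have hne : (1 + Complex.exp w) ^ n ≠ 0 :=
        pow_ne_zero _ (norm_pos_iff.1 (hone _ (hre_exp w hw'.1 (hw'.2.trans_lt h2))))
      apply DifferentiableAt.differentiableWithinAt
      have := hF.differentiableAt (x := Complex.exp w)
      refine ((this.comp w Complex.differentiableAt_exp).div ?_ hne).mul ?_ <;> fun_prop
    have hbound : ∀ w : ℂ, 0 ≤ w.im → w.im ≤ θ → ‖Φ w‖ ≤ C * 2 ^ n *
        Real.exp (a * (Complex.exp w).re ^ 2
          - A * (2 * (Complex.exp w).re * (Complex.exp w).im)) := by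
      intro w h3 h4
      have h5 := hre_exp w h3 (h4.trans_lt h2)
      rw [hnorm, sub_eq_add_neg, Real.exp_add, ← mul_assoc (C * 2 ^ n)]
      refine mul_le_mul_of_nonneg_right ?_ (Real.exp_pos _).le
      rw [div_le_iff₀ (pow_pos (hone _ h5) n)]
      refine (hexp _).trans ?_
      have := mul_le_mul_of_nonneg_right (hmono _ h5)
        (Real.exp_pos (a * (Complex.exp w).re ^ 2)).le
      linarith
    have hPL : ‖Φ ζ‖ ≤ C * 2 ^ n := by
      refine PhragmenLindelof.horizontal_strip (a := 0) (b := θ) hd ⟨2, ?_, a, ?_⟩ ?_ ?_ ?_ ?_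
      · rw [sub_zero, lt_div_iff₀ hθ]; linarith
      · refine Asymptotics.IsBigO.of_bound (C * 2 ^ n) ?_
        refine Filter.Eventually.filter_mono inf_le_right ?_
        rw [Filter.eventually_principal]
        intro w hw
        refine (hbound w hw.1.le hw.2.le).trans ?_
        rw [Real.norm_of_nonneg (Real.exp_pos _).le]
        gcongr
        have h5 := hre_exp w hw.1.le (hw.2.trans h2)
        have h6 : 0 ≤ (Complex.exp w).im := by
          rw [Complex.exp_im]
          have := Real.sin_nonneg_of_nonneg_of_le_pi hw.1.le
            (by linarith [hw.2, Real.pi_pos])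
          positivity
        have h7 : (Complex.exp w).re ^ 2 ≤ Real.exp (2 * |w.re|) := by
          have h8 : (Complex.exp w).re ≤ Real.exp |w.re| := by
            refine (Complex.re_le_norm _).trans ?_
            rw [Complex.norm_exp]
            exact Real.exp_le_exp.2 (le_abs_self _)
          calc (Complex.exp w).re ^ 2 ≤ Real.exp |w.re| ^ 2 := by gcongr
            _ = Real.exp (2 * |w.re|) := by rw [← Real.exp_nat_mul]; norm_num
        have h9 : 0 ≤ A * (2 * (Complex.exp w).re * (Complex.exp w).im) := by positivity
        nlinarith
      · intro w hw
        have hw' : Complex.exp w = (Real.exp w.re : ℂ) := by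
          rw [Complex.ofReal_exp]
          congr 1
          exact Complex.ext rfl (by simp [hw])
        rw [hnorm, hw']
        have h5 : 0 ≤ ((Real.exp w.re : ℝ) : ℂ).re := by
          rw [Complex.ofReal_re]; exact (Real.exp_pos _).le
        rw [Complex.ofReal_im, mul_zero, mul_zero, neg_zero, Real.exp_zero, mul_one,
          div_le_iff₀ (pow_pos (hone _ h5) n)]
        exact (hreal _ (Real.exp_pos _).le).trans (hmono _ h5)
      · intro w hw
        refine (hbound w (by rw [hw]; exact hθ.le) hw.le).trans ?_
        have : a * (Complex.exp w).re ^ 2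
            - A * (2 * (Complex.exp w).re * (Complex.exp w).im) = 0 := by
          rw [Complex.exp_re, Complex.exp_im, hw, hA]
          field_simp
          ring
        rw [this, Real.exp_zero, mul_one]
      · rw [hζim]; exact harg0
      · rw [hζim]; exact h1.le
    rw [hnorm, hexpζ, Real.exp_neg, ← div_eq_mul_inv,
      div_le_iff₀ (Real.exp_pos _), div_le_iff₀ (pow_pos (hone _ hre.le) n)] at hPL
    linarith
  have hlim : Filter.Tendsto (fun θ : ℝ => C * 2 ^ n * ‖1 + z‖ ^ n
        * Real.exp (a / 2 * (Real.cos θ / Real.sin θ) * (2 * z.re * z.im)))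
      (nhdsWithin (Real.pi / 2) (Set.Iio (Real.pi / 2))) (nhds (C * 2 ^ n * ‖1 + z‖ ^ n)) := by
    have hc : ContinuousAt (fun θ : ℝ => C * 2 ^ n * ‖1 + z‖ ^ n
        * Real.exp (a / 2 * (Real.cos θ / Real.sin θ) * (2 * z.re * z.im))) (Real.pi / 2) := by
      have : Real.sin (Real.pi / 2) ≠ 0 := by simp
      fun_prop (disch := assumption)
    have := hc.tendsto
    simp only [Real.cos_pi_div_two, zero_div, mul_zero, zero_mul, Real.exp_zero, mul_one] at this
    exact this.mono_left nhdsWithin_le_nhds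
  have hfin : ‖F z‖ ≤ C * 2 ^ n * ‖1 + z‖ ^ n := by
    refine ge_of_tendsto hlim ?_
    filter_upwards [Ioo_mem_nhdsLT harg1] with θ hθ
    exact hsector θ hθ.1 hθ.2
  refine hfin.trans ?_
  gcongr
  simpa using norm_add_le (1 : ℂ) z

open Complex in
/-- An entire function of growth `exp (a (re z) ^ 2)`, up to a polynomial factor, that grows
polynomially on the real line grows polynomially. -/
theorem norm_le_polynomial_of_real_line {F : ℂ → ℂ} (hF : Differentiable ℂ F) {a C : ℝ} {n : ℕ}
    (ha : 0 < a) (hC : 0 ≤ C)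
    (hexp : ∀ z : ℂ, ‖F z‖ ≤ C * (1 + ‖z‖) ^ n * Real.exp (a * z.re ^ 2))
    (hreal : ∀ x : ℝ, ‖F x‖ ≤ C * (1 + ‖(x : ℂ)‖) ^ n) (z : ℂ) :
    ‖F z‖ ≤ C * 2 ^ n * (1 + ‖z‖) ^ n := by
  -- The map `w ↦ -w` carries the third quadrant to the first; conjugating `F` then covers the
  -- second and fourth.
  have hneg : ∀ {G : ℂ → ℂ}, Differentiable ℂ G →
      (∀ z : ℂ, ‖G z‖ ≤ C * (1 + ‖z‖) ^ n * Real.exp (a * z.re ^ 2)) →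
      (∀ x : ℝ, ‖G x‖ ≤ C * (1 + ‖(x : ℂ)‖) ^ n) → ∀ z : ℂ, 0 ≤ z.re * z.im →
      ‖G z‖ ≤ C * 2 ^ n * (1 + ‖z‖) ^ n := by
    intro G hG h1 h2 z hz
    rcases mul_nonneg_iff.1 hz with ⟨h3, h4⟩ | ⟨h3, h4⟩
    · exact norm_le_polynomial_of_quadrant hG ha hC h1 (fun x _ => h2 x) h3 h4
    · have := norm_le_polynomial_of_quadrant (F := fun w => G (-w)) (z := -z)
        (hG.comp differentiable_neg) ha hC (fun w => by simpa using h1 (-w))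
        (fun x _ => by simpa using h2 (-x)) (by simpa using h3) (by simpa using h4)
      simpa using this
  rcases le_total 0 (z.re * z.im) with hz | hz
  · exact hneg hF hexp hreal z hz
  · have := hneg (G := fun w => (starRingEnd ℂ) (F ((starRingEnd ℂ) w)))
      (fun w => by simpa [Function.comp_def] using (hF ((starRingEnd ℂ) w)).conj_conj)
      (fun w => by simpa using hexp ((starRingEnd ℂ) w))
      (fun x => by simpa using hreal x) ((starRingEnd ℂ) z) (by simpa using hz)
    simpa using this

/-- An entire function of polynomial growth of degree `n` is a polynomial of degree at most `n`. -/
theorem eq_sum_of_norm_le_polynomial {F : ℂ → ℂ} (hF : Differentiable ℂ F) {C : ℝ} {n : ℕ}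
    (hbound : ∀ z : ℂ, ‖F z‖ ≤ C * (1 + ‖z‖) ^ n) :
    ∃ p : ℕ → ℂ, ∀ z, F z = ∑ k ∈ Finset.range (n + 1), p k * z ^ k := by
  refine ⟨fun k => (k.factorial : ℂ)⁻¹ * iteratedDeriv k F 0, fun z => ?_⟩
  have hzero : ∀ k, n < k → iteratedDeriv k F 0 = 0 := by
    intro k hk
    have hest : ∀ R : ℝ, 0 < R →
        ‖iteratedDeriv k F 0‖ ≤ k.factorial * (C * (1 + R) ^ n) / R ^ k := by
      intro R hR
      refine Complex.norm_iteratedDeriv_le_of_forall_mem_sphere_norm_le k hR hF.diffContOnCl ?_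
      intro w hw
      have : ‖w‖ = R := by simpa using hw
      simpa [this] using hbound w
    have hlim : Filter.Tendsto (fun R : ℝ => k.factorial * (C * (1 + R) ^ n) / R ^ k)
        Filter.atTop (nhds 0) := by
      have h1 := Polynomial.div_tendsto_atTop_zero_of_degree_lt
        (Polynomial.C ((k.factorial : ℝ) * C) * (1 + Polynomial.X) ^ n) (Polynomial.X ^ k) (by
          rw [Polynomial.degree_X_pow]
          have h1 : (1 + Polynomial.X : Polynomial ℝ).degree = 1 := by
            rw [add_comm, ← Polynomial.C_1]; exact Polynomial.degree_X_add_C 1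
          refine (Polynomial.degree_mul_le_of_le Polynomial.degree_C_le le_rfl).trans_lt ?_
          rw [Polynomial.degree_pow, h1]
          simpa using hk)
      simpa [mul_assoc] using h1
    have : ‖iteratedDeriv k F 0‖ ≤ 0 := by
      refine ge_of_tendsto hlim ?_
      filter_upwards [Filter.eventually_gt_atTop 0] with R hR using hest R hR
    exact norm_le_zero_iff.1 this
  have h := Complex.taylorSeries_eq_of_entire' 0 z hF
  rw [← h, tsum_eq_sum (s := Finset.range (n + 1))]
  · simp
  · intro k hk
    rw [hzero k (by simpa using hk)]
    simp

/-- **Hardy's theorem**, in its complex-analytic form. -/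
theorem eq_sum_of_exp_growth_of_real_line {F : ℂ → ℂ} (hF : Differentiable ℂ F) {a C : ℝ} {n : ℕ}
    (ha : 0 < a) (hC : 0 ≤ C)
    (hexp : ∀ z : ℂ, ‖F z‖ ≤ C * (1 + ‖z‖) ^ n * Real.exp (a * z.re ^ 2))
    (hreal : ∀ x : ℝ, ‖F x‖ ≤ C * (1 + ‖(x : ℂ)‖) ^ n) :
    ∃ p : ℕ → ℂ, ∀ z, F z = ∑ k ∈ Finset.range (n + 1), p k * z ^ k :=
  eq_sum_of_norm_le_polynomial hF (norm_le_polynomial_of_real_line hF ha hC hexp hreal)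

/-! ### Even Hermite functions of degree at most four -/

/-- The polynomial `c + 2 a H₂ + b H₄` in the variable `u = 4πx²`. -/
def hermiteQuadratic (c a b u : ℝ) : ℝ :=
  c + 2 * a * (u - 1) + b * (u ^ 2 - 6 * u + 3)

/-- The even Hermite function `(c H₀ + 2 a H₂ + b H₄) e^{-πx²}`. -/
noncomputable def evenHermite (c a b x : ℝ) : ℝ :=
  hermiteQuadratic c a b (4 * Real.pi * x ^ 2) * Real.exp (-Real.pi * x ^ 2)

theorem hermiteFab_eq_evenHermite (a b : ℝ) : hermiteFab a b = evenHermite 1 a b := by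
  funext x
  simp only [hermiteFab, evenHermite, hermiteQuadratic, hermiteH_zero, hermiteH_two, hermiteH_four]

theorem continuous_evenHermite (c a b : ℝ) : Continuous (evenHermite c a b) := by
  unfold evenHermite hermiteQuadratic
  fun_prop

/-! ### Gaussian moments and the Laplace transform -/

section Moments

open ProbabilityTheory MeasureTheory
open scoped NNReal

theorem hasDerivAt_integral_pow_mul_cexp_gaussianReal (v : ℝ≥0) (n : ℕ) (z : ℂ) :
    HasDerivAt (fun z : ℂ => ∫ x : ℝ, (x : ℂ) ^ n * Complex.exp (z * x) ∂(gaussianReal 0 v))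
      (∫ x : ℝ, (x : ℂ) ^ (n + 1) * Complex.exp (z * x) ∂(gaussianReal 0 v)) z := by
  have := hasDerivAt_integral_pow_mul_exp (X := id) (μ := gaussianReal 0 v) (z := z)
    (by rw [integrableExpSet_id_gaussianReal]; simp) n
  simpa using this

theorem integral_cexp_gaussianReal (v : ℝ≥0) (z : ℂ) :
    ∫ x : ℝ, Complex.exp (z * x) ∂(gaussianReal 0 v) = Complex.exp (v * z ^ 2 / 2) := by
  have := complexMGF_id_gaussianReal (μ := 0) (v := v) z
  simpa [complexMGF] using this

/-- Differentiating in `z` under the integral raises the power of `x` by one; on the closed form it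
acts as `p ↦ p' + v z p`. -/
theorem integral_pow_succ_mul_cexp_gaussianReal {v : ℝ≥0} {n : ℕ} {p p' : ℂ → ℂ}
    (hp : ∀ z, HasDerivAt p (p' z) z)
    (h : ∀ z : ℂ, ∫ x : ℝ, (x : ℂ) ^ n * Complex.exp (z * x) ∂(gaussianReal 0 v)
      = p z * Complex.exp (v * z ^ 2 / 2)) (z : ℂ) :
    ∫ x : ℝ, (x : ℂ) ^ (n + 1) * Complex.exp (z * x) ∂(gaussianReal 0 v)
      = (p' z + v * z * p z) * Complex.exp (v * z ^ 2 / 2) := by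
  have h1 := hasDerivAt_integral_pow_mul_cexp_gaussianReal v n z
  rw [funext h] at h1
  have h2 : HasDerivAt (fun z : ℂ => (v : ℂ) * z ^ 2 / 2) (v * z) z := by
    have := ((hasDerivAt_pow 2 z).const_mul (v : ℂ)).div_const 2
    refine this.congr_deriv ?_
    push_cast
    ring
  rw [h1.unique ((hp z).mul h2.cexp)]
  ring

theorem integral_sq_mul_cexp_gaussianReal (v : ℝ≥0) (z : ℂ) :
    ∫ x : ℝ, (x : ℂ) ^ 2 * Complex.exp (z * x) ∂(gaussianReal 0 v)
      = (v + v ^ 2 * z ^ 2) * Complex.exp (v * z ^ 2 / 2) := by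
  have h0 : ∀ z : ℂ, ∫ x : ℝ, (x : ℂ) ^ 0 * Complex.exp (z * x) ∂(gaussianReal 0 v)
      = 1 * Complex.exp (v * z ^ 2 / 2) := by
    intro z; simpa using integral_cexp_gaussianReal v z
  have h1 := integral_pow_succ_mul_cexp_gaussianReal (p := fun _ => 1)
    (fun z => hasDerivAt_const z 1) h0
  have h2 := integral_pow_succ_mul_cexp_gaussianReal (p := fun z => 0 + v * z * 1)
    (p' := fun _ => (v : ℂ)) (fun z => by
      simpa using (hasDerivAt_id z).const_mul (v : ℂ)) h1
  rw [h2 z]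
  ring

theorem integral_pow_four_mul_cexp_gaussianReal (v : ℝ≥0) (z : ℂ) :
    ∫ x : ℝ, (x : ℂ) ^ 4 * Complex.exp (z * x) ∂(gaussianReal 0 v)
      = (3 * v ^ 2 + 6 * v ^ 3 * z ^ 2 + v ^ 4 * z ^ 4) * Complex.exp (v * z ^ 2 / 2) := by
  have hpow (k : ℕ) (z : ℂ) : HasDerivAt (fun z : ℂ => z ^ k) (k * z ^ (k - 1)) z :=
    hasDerivAt_pow k z
  have h3 := integral_pow_succ_mul_cexp_gaussianReal (p := fun z => v + v ^ 2 * z ^ 2)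
    (p' := fun z => (v : ℂ) ^ 2 * ((2 : ℕ) * z ^ (2 - 1)))
    (fun z => by simpa using ((hpow 2 z).const_mul ((v : ℂ) ^ 2)).const_add (v : ℂ))
    (integral_sq_mul_cexp_gaussianReal v)
  have h3' : ∀ z : ℂ, ∫ x : ℝ, (x : ℂ) ^ 3 * Complex.exp (z * x) ∂(gaussianReal 0 v)
      = (3 * v ^ 2 * z + v ^ 3 * z ^ 3) * Complex.exp (v * z ^ 2 / 2) := by
    intro z; rw [h3 z]; push_cast; ring
  have h4 := integral_pow_succ_mul_cexp_gaussianReal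
    (p := fun z => 3 * v ^ 2 * z + v ^ 3 * z ^ 3)
    (p' := fun z => 3 * (v : ℂ) ^ 2 + (v : ℂ) ^ 3 * ((3 : ℕ) * z ^ (3 - 1)))
    (fun z => by
      have := ((hasDerivAt_id z).const_mul (3 * (v : ℂ) ^ 2)).fun_add
        ((hpow 3 z).const_mul ((v : ℂ) ^ 3))
      simpa using this)
    h3'
  rw [h4 z]
  push_cast
  ring

theorem integrable_pow_mul_cexp_gaussianReal (v : ℝ≥0) (n : ℕ) (z : ℂ) :
    Integrable (fun x : ℝ => (x : ℂ) ^ n * Complex.exp (z * x)) (gaussianReal 0 v) := by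
  simpa using integrable_pow_mul_cexp_of_re_mem_interior_integrableExpSet (X := id)
    (μ := gaussianReal 0 v) (z := z) (by rw [integrableExpSet_id_gaussianReal]; simp) n

/-- The variance of the Gaussian density `e^{-πx²}`. -/
noncomputable def selfDualVariance : ℝ≥0 := ⟨(2 * Real.pi)⁻¹, by positivity⟩

theorem coe_selfDualVariance : (selfDualVariance : ℝ) = (2 * Real.pi)⁻¹ := rfl

theorem selfDualVariance_ne_zero : selfDualVariance ≠ 0 := by
  intro h
  have := congrArg NNReal.toReal h
  rw [coe_selfDualVariance] at this
  simp [Real.pi_ne_zero] at this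

theorem gaussianPDFReal_selfDualVariance (x : ℝ) :
    gaussianPDFReal 0 selfDualVariance x = Real.exp (-Real.pi * x ^ 2) := by
  have := Real.pi_ne_zero
  rw [gaussianPDFReal_def]
  simp only [coe_selfDualVariance]
  rw [mul_inv_cancel₀ (by positivity)]
  simp only [Real.sqrt_one, inv_one, one_mul, sub_zero]
  congr 1
  field_simp

theorem integral_gaussianReal_selfDualVariance (φ : ℝ → ℂ) :
    ∫ x, φ x ∂(gaussianReal 0 selfDualVariance)
      = ∫ x, (Real.exp (-Real.pi * x ^ 2) : ℂ) * φ x := by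
  rw [integral_gaussianReal_eq_integral_smul selfDualVariance_ne_zero]
  simp_rw [gaussianPDFReal_selfDualVariance, Complex.real_smul]

theorem integrable_gaussianReal_selfDualVariance {φ : ℝ → ℂ}
    (h : Integrable φ (gaussianReal 0 selfDualVariance)) :
    Integrable (fun x => (Real.exp (-Real.pi * x ^ 2) : ℂ) * φ x) := by
  rw [gaussianReal_of_var_ne_zero _ selfDualVariance_ne_zero,
    integrable_withDensity_iff_integrable_smul' (measurable_gaussianPDF _ _)
      (by simp [gaussianPDF])] at h
  refine h.congr (.of_forall fun x => ?_)
  simp only [gaussianPDF, gaussianPDFReal_selfDualVariance]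
  rw [ENNReal.toReal_ofReal (Real.exp_pos _).le, Complex.real_smul]

theorem evenHermite_mul_cexp_eq (c a b : ℝ) (w : ℂ) (x : ℝ) :
    (evenHermite c a b x : ℂ) * Complex.exp (w * x) = (Real.exp (-Real.pi * x ^ 2) : ℂ) *
      (((c - 2 * a + 3 * b) * ((x : ℂ) ^ 0 * Complex.exp (w * x))
        + (8 * Real.pi * a - 24 * Real.pi * b) * ((x : ℂ) ^ 2 * Complex.exp (w * x)))
        + (16 * Real.pi ^ 2 * b) * ((x : ℂ) ^ 4 * Complex.exp (w * x))) := by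
  simp only [evenHermite, hermiteQuadratic]
  push_cast
  ring

theorem integrable_evenHermite_mul_cexp (c a b : ℝ) (w : ℂ) :
    Integrable (fun x : ℝ => (evenHermite c a b x : ℂ) * Complex.exp (w * x)) := by
  simp_rw [evenHermite_mul_cexp_eq]
  have h := fun n => integrable_pow_mul_cexp_gaussianReal selfDualVariance n w
  exact integrable_gaussianReal_selfDualVariance
    ((((h 0).const_mul _).add ((h 2).const_mul _)).add ((h 4).const_mul _))

theorem integrable_evenHermite (c a b : ℝ) : Integrable (evenHermite c a b) := by
  have := (integrable_evenHermite_mul_cexp c a b 0).re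
  simpa using this

/-- The bilateral Laplace transform of an even Hermite function. -/
theorem integral_evenHermite_mul_cexp (c a b : ℝ) (w : ℂ) :
    ∫ x : ℝ, (evenHermite c a b x : ℂ) * Complex.exp (w * x) =
      (c + 2 * a * (w ^ 2 / Real.pi + 1)
        + b * ((w ^ 2 / Real.pi) ^ 2 + 6 * (w ^ 2 / Real.pi) + 3))
        * Complex.exp (w ^ 2 / (4 * Real.pi)) := by
  have hπ : (Real.pi : ℂ) ≠ 0 := Complex.ofReal_ne_zero.2 Real.pi_ne_zero
  have h := fun n => integrable_pow_mul_cexp_gaussianReal selfDualVariance n w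
  have hv : ((selfDualVariance : ℝ) : ℂ) = (2 * (Real.pi : ℂ))⁻¹ := by
    rw [coe_selfDualVariance]; push_cast; rfl
  have hE : (2 * (Real.pi : ℂ))⁻¹ * w ^ 2 / 2 = w ^ 2 / (4 * Real.pi) := by
    field_simp; ring
  have h02 : Integrable (fun x : ℝ => (c - 2 * a + 3 * b : ℂ) * ((x : ℂ) ^ 0 * Complex.exp (w * x))
      + (8 * Real.pi * a - 24 * Real.pi * b) * ((x : ℂ) ^ 2 * Complex.exp (w * x)))
      (gaussianReal 0 selfDualVariance) :=
    ((h 0).const_mul _).add ((h 2).const_mul _)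
  simp_rw [evenHermite_mul_cexp_eq]
  rw [← integral_gaussianReal_selfDualVariance
    (fun x : ℝ => ((c - 2 * a + 3 * b : ℂ) * ((x : ℂ) ^ 0 * Complex.exp (w * x))
        + (8 * Real.pi * a - 24 * Real.pi * b) * ((x : ℂ) ^ 2 * Complex.exp (w * x)))
        + (16 * Real.pi ^ 2 * b) * ((x : ℂ) ^ 4 * Complex.exp (w * x))),
    integral_add h02 ((h 4).const_mul _),
    integral_add ((h 0).const_mul _) ((h 2).const_mul _), integral_const_mul, integral_const_mul,
    integral_const_mul, integral_sq_mul_cexp_gaussianReal, integral_pow_four_mul_cexp_gaussianReal]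
  simp only [pow_zero, one_mul]
  rw [integral_cexp_gaussianReal, hv, hE]
  field_simp
  ring

/-- The Fourier transform maps `c H₀ + 2 a H₂ + b H₄` to `c H₀ - 2 a H₂ + b H₄`. -/
theorem integral_evenHermite_mul_cexp_I (c a b s : ℝ) :
    ∫ x : ℝ, (evenHermite c a b x : ℂ) * Complex.exp (2 * Real.pi * s * Complex.I * x) =
      evenHermite c (-a) b s := by
  have hπ : (Real.pi : ℂ) ≠ 0 := Complex.ofReal_ne_zero.2 Real.pi_ne_zero
  have hw : (2 * Real.pi * s * Complex.I) ^ 2 / Real.pi = -(4 * Real.pi * (s : ℂ) ^ 2) := by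
    rw [mul_pow, Complex.I_sq]; field_simp; ring
  have hw' : (2 * Real.pi * s * Complex.I) ^ 2 / (4 * Real.pi) = -Real.pi * (s : ℂ) ^ 2 := by
    rw [mul_pow, Complex.I_sq]; field_simp; ring
  rw [integral_evenHermite_mul_cexp, hw, hw']
  simp only [evenHermite, hermiteQuadratic]
  push_cast
  ring

theorem integral_evenHermite_mul_exp (c a b t : ℝ) :
    ∫ x : ℝ, evenHermite c a b x * Real.exp (t * x) =
      (c + 2 * a * (t ^ 2 / Real.pi + 1)
        + b * ((t ^ 2 / Real.pi) ^ 2 + 6 * (t ^ 2 / Real.pi) + 3))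
        * Real.exp (t ^ 2 / (4 * Real.pi)) := by
  have := integral_evenHermite_mul_cexp c a b t
  apply Complex.ofReal_injective
  rw [← integral_complex_ofReal]
  push_cast
  simpa using this

end Moments

/-! ### Positive definiteness and the Fourier transform -/

section PositiveDefinite

open ProbabilityTheory MeasureTheory
open scoped NNReal

theorem map_sub_pi_gaussianReal (v : ℝ≥0) {n : ℕ} {j k : Fin n} (hjk : j ≠ k) :
    (Measure.pi fun _ : Fin n => gaussianReal 0 v).map (fun x => x j - x k)
      = gaussianReal 0 (v + v) := by
  have hmap : ∀ i : Fin n, (Measure.pi fun _ : Fin n => gaussianReal 0 v).map (fun x => x i)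
      = gaussianReal 0 v := fun i =>
    (measurePreserving_eval (fun _ : Fin n => gaussianReal 0 v) i).map_eq
  have hind : iIndepFun (fun (i : Fin n) (x : Fin n → ℝ) => x i)
      (Measure.pi fun _ : Fin n => gaussianReal 0 v) :=
    iIndepFun_pi (X := fun _ => id) (fun _ => aemeasurable_id)
  have h2 : IndepFun (fun x : Fin n → ℝ => x j) (fun x => -x k)
      (Measure.pi fun _ : Fin n => gaussianReal 0 v) :=
    (hind.indepFun hjk).comp measurable_id measurable_neg
  have h3 : (Measure.pi fun _ : Fin n => gaussianReal 0 v).map (fun x => -x k)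
      = gaussianReal 0 v := by
    have := Measure.map_map (μ := Measure.pi fun _ : Fin n => gaussianReal 0 v)
      measurable_neg (measurable_pi_apply k)
    rw [hmap k, gaussianReal_map_neg, neg_zero] at this
    exact this.symm
  have := gaussianReal_add_gaussianReal_of_indepFun h2 (hmap j) h3
  simpa [Pi.add_def, sub_eq_add_neg] using this

/-- The hypothesis is averaged over `n + 1` independent Gaussian points. Diagonal terms contribute
`φ 0`, off-diagonal ones the integral `m`, so `φ 0 + n m ≥ 0` for every `n`, which forces `m ≥ 0`.
-/
theorem integral_gaussianReal_nonneg_of_sum_nonneg {φ : ℝ → ℝ} (hφ : Continuous φ) {C : ℝ}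
    (hC : ∀ t, ‖φ t‖ ≤ C)
    (hpos : ∀ (n : ℕ) (x : Fin n → ℝ), 0 ≤ ∑ j, ∑ k, φ (x j - x k)) (v : ℝ≥0) :
    0 ≤ ∫ t, φ t ∂(gaussianReal 0 (v + v)) := by
  set m := ∫ t, φ t ∂(gaussianReal 0 (v + v)) with hm
  have hsum : ∀ n : ℕ, 0 ≤ φ 0 + n * m := by
    intro n
    set P := Measure.pi fun _ : Fin (n + 1) => gaussianReal 0 v with hP
    have hint : ∀ j k : Fin (n + 1), Integrable (fun x => φ (x j - x k)) P := fun j k =>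
      Integrable.of_bound (C := C)
        (Continuous.aestronglyMeasurable (by fun_prop)) (.of_forall fun x => hC _)
    have hval : ∀ j k : Fin (n + 1), ∫ x, φ (x j - x k) ∂P = if j = k then φ 0 else m := by
      intro j k
      split_ifs with h
      · simp [h]
      · rw [hm, ← map_sub_pi_gaussianReal v h, integral_map (by fun_prop)
          hφ.aestronglyMeasurable]
    have h0 : 0 ≤ ∫ x, ∑ j, ∑ k, φ (x j - x k) ∂P := integral_nonneg fun x => hpos _ x
    rw [integral_finsetSum _ fun j _ => integrable_finsetSum _ fun k _ => hint j k] at h0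
    simp_rw [integral_finsetSum _ fun k _ => hint _ k, hval] at h0
    have hinner : ∀ j : Fin (n + 1), (∑ k, if j = k then φ 0 else m) = φ 0 + n * m := by
      intro j
      have : ∀ k, (if j = k then φ 0 else m) = (if j = k then φ 0 - m else 0) + m := by
        intro k; split_ifs <;> ring
      simp_rw [this, Finset.sum_add_distrib]
      simp
      ring
    simp_rw [hinner] at h0
    simp only [Finset.sum_const, Finset.card_univ, Fintype.card_fin, nsmul_eq_mul] at h0
    exact nonneg_of_mul_nonneg_right h0 (by positivity)
  by_contra! hneg
  obtain ⟨n, hn⟩ := exists_nat_gt (φ 0 / -m)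
  rw [div_lt_iff₀ (by linarith)] at hn
  linarith [hsum n]

/-- Gaussians of variance `2(n + 1)`, stripped of their normalising constants, increase to 1, so
dominated convergence passes from Gaussian measures to Lebesgue measure. -/
theorem integral_nonneg_of_sum_nonneg {φ : ℝ → ℝ} (hφ : Continuous φ) {C : ℝ}
    (hC : ∀ t, ‖φ t‖ ≤ C) (hint : Integrable φ)
    (hpos : ∀ (n : ℕ) (x : Fin n → ℝ), 0 ≤ ∑ j, ∑ k, φ (x j - x k)) :
    0 ≤ ∫ t, φ t := by
  have hn : ∀ n : ℕ, 0 ≤ ∫ t, Real.exp (-t ^ 2 / (4 * (n + 1))) * φ t := by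
    intro n
    have h := integral_gaussianReal_nonneg_of_sum_nonneg hφ hC hpos (n + 1)
    have hv : ((n : ℝ≥0) + 1 + (n + 1)) ≠ 0 := by positivity
    rw [integral_gaussianReal_eq_integral_smul hv] at h
    simp only [gaussianPDFReal_def, smul_eq_mul, mul_assoc, sub_zero] at h
    rw [integral_const_mul] at h
    have hc : 0 < (√(2 * (Real.pi * (((n : ℝ≥0) + 1 + (n + 1) : ℝ≥0) : ℝ))))⁻¹ := by
      positivity
    have h' := nonneg_of_mul_nonneg_right h hc
    refine h'.trans_eq (integral_congr_ae (.of_forall fun t => ?_))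
    have : 2 * (((n : ℝ≥0) + 1 + (n + 1) : ℝ≥0) : ℝ) = 4 * (n + 1) := by push_cast; ring
    simp only [this]
  have hlim : Filter.Tendsto (fun n : ℕ => ∫ t, Real.exp (-t ^ 2 / (4 * (n + 1))) * φ t)
      Filter.atTop (nhds (∫ t, φ t)) := by
    refine tendsto_integral_of_dominated_convergence (fun t => ‖φ t‖)
      (fun n => Continuous.aestronglyMeasurable (by fun_prop)) hint.norm ?_ ?_
    · refine fun n => .of_forall fun t => ?_
      rw [norm_mul, Real.norm_of_nonneg (Real.exp_pos _).le]
      refine mul_le_of_le_one_left (norm_nonneg _) (Real.exp_le_one_iff.2 ?_)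
      rw [neg_div]
      have : 0 ≤ t ^ 2 / (4 * ((n : ℝ) + 1)) := by positivity
      linarith
    · refine .of_forall fun t => ?_
      have h1 : Filter.Tendsto (fun n : ℕ => -t ^ 2 / (4 * ((n : ℝ) + 1)))
          Filter.atTop (nhds 0) := by
        have := (tendsto_one_div_add_atTop_nhds_zero_nat (𝕜 := ℝ)).const_mul (-t ^ 2 / 4)
        rw [mul_zero] at this
        refine this.congr fun n => ?_
        field_simp
      have h2 := ((Real.continuous_exp.tendsto 0).comp h1).mul_const (φ t)
      simpa using h2
  exact ge_of_tendsto' hlim hn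

theorem PosPosDef.le_apply_zero {f : ℝ → ℝ} (hf : f ∈ PosPosDef) (t : ℝ) : f t ≤ f 0 := by
  have h := (hf.1.2 2 ![t, 0] ![1, -1]).2
  have he := PosPosDef.even hf t
  simp [Fin.sum_univ_two, he] at h
  linarith

theorem PosPosDef.continuous {f : ℝ → ℝ} (hf : f ∈ PosPosDef) : Continuous f := by
  simpa [Function.comp_def] using Complex.continuous_re.comp hf.1.1

/-- The cosine transform of an integrable positive positive definite function is nonnegative. -/
theorem PosPosDef.integral_mul_cos_nonneg {f : ℝ → ℝ} (hf : f ∈ PosPosDef) (hint : Integrable f)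
    (s : ℝ) : 0 ≤ ∫ t, f t * Real.cos (s * t) := by
  have hcont := PosPosDef.continuous hf
  have hle : ∀ t, ‖f t * Real.cos (s * t)‖ ≤ ‖f t‖ := by
    intro t
    rw [norm_mul]
    exact mul_le_of_le_one_right (norm_nonneg _) (Real.abs_cos_le_one _)
  refine integral_nonneg_of_sum_nonneg (by fun_prop) (C := f 0) (fun t => ?_)
    (hint.mono (Continuous.aestronglyMeasurable (by fun_prop)) (.of_forall hle)) ?_
  · refine (hle t).trans ?_
    rw [Real.norm_of_nonneg (hf.2 t)]
    exact PosPosDef.le_apply_zero hf t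
  · intro n x
    -- The coefficients `e^{i s x_j}` twist `f(t)` into `f(t) e^{ist}`, whose real part is the
    -- integrand.
    have h := (hf.1.2 n x (fun j => Complex.exp ((s * x j : ℝ) * Complex.I))).2
    rw [Complex.re_sum] at h
    refine h.trans_eq (Finset.sum_congr rfl fun j _ => ?_)
    rw [Complex.re_sum]
    refine Finset.sum_congr rfl fun k _ => ?_
    rw [← Complex.exp_conj, ← Complex.exp_add, Complex.re_mul_ofReal]
    have : ((s * x j : ℝ) : ℂ) * Complex.I
        + (starRingEnd ℂ) (((s * x k : ℝ) : ℂ) * Complex.I)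
        = ((s * (x j - x k) : ℝ) : ℂ) * Complex.I := by
      simp
      ring
    rw [this, Complex.exp_ofReal_mul_I_re, mul_comm]

/-- The Fourier transform of a nonnegative integrable function is positive definite. -/
theorem isPositiveDefinite_of_integral {f : ℝ → ℂ} (hf : Continuous f) {g : ℝ → ℝ}
    (hg : ∀ y, 0 ≤ g y) (hint : Integrable g)
    (hfg : ∀ s : ℝ, f s = ∫ y : ℝ, (g y : ℂ) * Complex.exp (2 * Real.pi * s * Complex.I * y)) :
    IsPositiveDefinite f := by
  refine ⟨hf, fun n x c => ?_⟩
  let e : ℝ → ℝ → ℂ := fun s y => Complex.exp (2 * Real.pi * s * Complex.I * y)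
  have hnorm : ∀ s y, ‖e s y‖ = 1 := by
    intro s y
    have : (2 * Real.pi * s * Complex.I * y : ℂ)
        = ((2 * Real.pi * s * y : ℝ) : ℂ) * Complex.I := by push_cast; ring
    simp only [e, this, Complex.norm_exp_ofReal_mul_I]
  have hi : ∀ s, Integrable fun y => (g y : ℂ) * e s y := by
    intro s
    refine hint.ofReal.mul_bdd (c := 1) ?_ ?_
    · exact Continuous.aestronglyMeasurable (by fun_prop)
    · exact .of_forall fun y => (hnorm s y).le
  have hsum : ∑ j, ∑ k, c j * (starRingEnd ℂ) (c k) * f (x j - x k)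
      = ((∫ y : ℝ, g y * Complex.normSq (∑ j, c j * e (x j) y) : ℝ) : ℂ) := by
    rw [← integral_complex_ofReal]
    have hpt : ∀ y : ℝ, ((g y * Complex.normSq (∑ j, c j * e (x j) y) : ℝ) : ℂ)
        = ∑ j, ∑ k, c j * (starRingEnd ℂ) (c k) * ((g y : ℂ) * e (x j - x k) y) := by
      intro y
      rw [Complex.ofReal_mul, Complex.normSq_eq_conj_mul_self, map_sum, mul_comm,
        mul_comm (∑ j, (starRingEnd ℂ) (c j * e (x j) y)),
        Finset.sum_mul_sum, Finset.sum_mul]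
      refine Finset.sum_congr rfl fun j _ => ?_
      rw [Finset.sum_mul]
      refine Finset.sum_congr rfl fun k _ => ?_
      have he : e (x j - x k) y = e (x j) y * (starRingEnd ℂ) (e (x k) y) := by
        simp only [e]
        rw [← Complex.exp_conj, ← Complex.exp_add]
        congr 1
        simp [Complex.conj_ofNat]
        ring
      rw [he, map_mul]
      ring
    simp_rw [hpt]
    rw [integral_finsetSum _ fun j _ => integrable_finsetSum _ fun k _ => (hi _).const_mul _]
    refine Finset.sum_congr rfl fun j _ => ?_
    rw [integral_finsetSum _ fun k _ => (hi _).const_mul _]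
    refine Finset.sum_congr rfl fun k _ => ?_
    rw [integral_const_mul, hfg]
  rw [hsum]
  exact ⟨Complex.ofReal_im _, by
    rw [Complex.ofReal_re]
    exact integral_nonneg fun y => mul_nonneg (hg y) (Complex.normSq_nonneg _)⟩

end PositiveDefinite

/-! ### The nonnegativity criterion -/

/-- By symmetry `a ≥ 0`. For `b > 0` the quadratic with `-a` has its vertex at `u = 3 + a/b ≥ 0`, so
its minimum value decides. Completing the square shows that the same condition also suffices for the
other quadratic, since `ab ≥ 0`. -/
theorem hermiteQuadratic_nonneg_iff {c a b : ℝ} :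
    ((∀ u, 0 ≤ u → 0 ≤ hermiteQuadratic c a b u) ∧
      ∀ u, 0 ≤ u → 0 ≤ hermiteQuadratic c (-a) b u) ↔
    0 ≤ c ∧ a ^ 2 + 4 * |a| * b + 6 * b ^ 2 ≤ c * b := by
  wlog ha : 0 ≤ a generalizing a
  · have := this (a := -a) (by linarith)
    rw [neg_neg, abs_neg, neg_sq] at this
    rw [and_comm, this]
  rw [abs_of_nonneg ha]
  simp only [hermiteQuadratic]
  constructor
  · rintro ⟨h1, h2⟩
    have hsum : ∀ u, 0 ≤ u → 0 ≤ c + b * (u ^ 2 - 6 * u + 3) := fun u hu => by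
      linarith [h1 u hu, h2 u hu]
    have hb : 0 ≤ b := by
      by_contra! hb
      -- At `u = 6 + t` the averaged quadratic is `c + b(t² + 6t + 3)`, and `bt = -(|c| + 1)`
      -- already makes it negative.
      set t := (|c| + 1) / -b with ht
      have ht0 : 0 ≤ t := div_nonneg (by positivity) (by linarith)
      have hbt : b * t = -(|c| + 1) := by
        have := hb.ne
        rw [ht]; field_simp
      have := hsum (6 + t) (by linarith)
      nlinarith [le_abs_self c, mul_nonneg (neg_pos.2 hb).le (sq_nonneg t)]
    have h3 := hsum 3 (by norm_num)
    refine ⟨by linarith, ?_⟩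
    rcases hb.eq_or_lt with rfl | hb
    · rcases ha.eq_or_lt with rfl | ha
      · simp
      · exfalso
        have h4 : 0 ≤ (c + 1) / (2 * a) := div_nonneg (by linarith) (by linarith)
        -- With `b = 0` the second polynomial is `c - 2a(u - 1)`, which equals `-1` at this point.
        have h5 := h2 (1 + (c + 1) / (2 * a)) (by linarith)
        have h6 : 2 * a * ((c + 1) / (2 * a)) = c + 1 := by field_simp
        nlinarith
    · have h4 := mul_nonneg hb.le (h2 ((a + 3 * b) / b) (by positivity))
      have h5 : b * (c + 2 * -a * ((a + 3 * b) / b - 1)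
          + b * (((a + 3 * b) / b) ^ 2 - 6 * ((a + 3 * b) / b) + 3))
          = c * b - (a ^ 2 + 4 * a * b + 6 * b ^ 2) := by
        field_simp
        ring
      linarith
  · rintro ⟨hc, h⟩
    have hb : 0 ≤ b := by
      by_contra! hb
      nlinarith [sq_nonneg (a + 2 * b), mul_pos_of_neg_of_neg hb hb]
    rcases hb.eq_or_lt with rfl | hb
    · have : a = 0 := by nlinarith
      subst this
      simp [hc]
    · have hab : 0 ≤ a * b := by positivity
      constructor <;> intro u _ <;> refine nonneg_of_mul_nonneg_right ?_ hb
      · nlinarith [sq_nonneg (b * u + a - 3 * b)]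
      · nlinarith [sq_nonneg (b * u - a - 3 * b)]

/-! ### Cosine transforms and the membership criterion -/

section CosineTransform

open MeasureTheory

theorem integrable_mul_cexp_I {g : ℝ → ℝ} (hint : Integrable g) (s : ℝ) :
    Integrable fun x : ℝ => (g x : ℂ) * Complex.exp (2 * Real.pi * s * Complex.I * x) := by
  refine hint.ofReal.mul_bdd (c := 1) (Continuous.aestronglyMeasurable (by fun_prop)) ?_
  refine .of_forall fun x => ?_
  have : (2 * Real.pi * s * Complex.I * x : ℂ)
      = ((2 * Real.pi * s * x : ℝ) : ℂ) * Complex.I := by push_cast; ring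
  rw [this, Complex.norm_exp_ofReal_mul_I]

/-- The Fourier transform of an even real function is its cosine transform. -/
theorem integral_mul_cexp_I_eq_cos {g : ℝ → ℝ} (heven : g.Even) (hint : Integrable g) (s : ℝ) :
    ∫ x : ℝ, (g x : ℂ) * Complex.exp (2 * Real.pi * s * Complex.I * x)
      = ((∫ x : ℝ, g x * Real.cos (2 * Real.pi * s * x) : ℝ) : ℂ) := by
  have hi := integrable_mul_cexp_I hint s
  have hpt : ∀ x : ℝ, (g x : ℂ) * Complex.exp (2 * Real.pi * s * Complex.I * x)
      = (g x : ℂ) * Complex.exp (((2 * Real.pi * s * x : ℝ) : ℂ) * Complex.I) := by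
    intro x; congr 2; push_cast; ring
  apply Complex.ext
  · have := integral_re hi
    simp only [RCLike.re_to_complex] at this
    rw [← this, Complex.ofReal_re]
    simp_rw [hpt, Complex.re_ofReal_mul, Complex.exp_ofReal_mul_I_re]
  · have := integral_im hi
    simp only [RCLike.im_to_complex] at this
    rw [← this, Complex.ofReal_im]
    simp_rw [hpt, Complex.im_ofReal_mul, Complex.exp_ofReal_mul_I_im]
    have hodd := integral_neg_eq_self (fun x : ℝ => g x * Real.sin (2 * Real.pi * s * x)) volume
    simp only [heven _, mul_neg, Real.sin_neg] at hodd
    rw [integral_neg] at hodd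
    linarith

theorem even_evenHermite (c a b : ℝ) : (evenHermite c a b).Even := by
  intro x
  simp [evenHermite]

theorem integral_evenHermite_mul_cos (c a b s : ℝ) :
    ∫ x : ℝ, evenHermite c a b x * Real.cos (2 * Real.pi * s * x) = evenHermite c (-a) b s := by
  have h := integral_mul_cexp_I_eq_cos (even_evenHermite c a b) (integrable_evenHermite c a b) s
  rw [integral_evenHermite_mul_cexp_I] at h
  exact (Complex.ofReal_injective h).symm

theorem evenHermite_nonneg_iff {c a b : ℝ} :
    (∀ x, 0 ≤ evenHermite c a b x) ↔ ∀ u, 0 ≤ u → 0 ≤ hermiteQuadratic c a b u := by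
  constructor
  · intro h u hu
    have h1 := nonneg_of_mul_nonneg_left (h √(u / (4 * Real.pi))) (Real.exp_pos _)
    have h2 : 4 * Real.pi * √(u / (4 * Real.pi)) ^ 2 = u := by
      have := Real.pi_pos
      rw [Real.sq_sqrt (by positivity)]
      field_simp
    rwa [h2] at h1
  · intro h x
    have := Real.pi_pos
    exact mul_nonneg (h _ (by positivity)) (Real.exp_pos _).le

/-- The positive positive definite even Hermite functions of degree at most four. -/
theorem evenHermite_mem_posPosDef_iff {c a b : ℝ} :
    evenHermite c a b ∈ PosPosDef ↔ 0 ≤ c ∧ a ^ 2 + 4 * |a| * b + 6 * b ^ 2 ≤ c * b := by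
  rw [← hermiteQuadratic_nonneg_iff, ← evenHermite_nonneg_iff, ← evenHermite_nonneg_iff]
  constructor
  · intro h
    refine ⟨h.2, fun s => ?_⟩
    rw [← integral_evenHermite_mul_cos]
    exact PosPosDef.integral_mul_cos_nonneg h (integrable_evenHermite c a b) _
  · rintro ⟨h1, h2⟩
    refine ⟨isPositiveDefinite_of_integral
      (Complex.continuous_ofReal.comp (continuous_evenHermite c a b)) h2
      (integrable_evenHermite c (-a) b) fun s => ?_, h1⟩
    rw [integral_evenHermite_mul_cexp_I, neg_neg]

/-- Continuous integrable functions with the same Fourier transform are equal. -/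
theorem eq_of_integral_mul_cexp_I_eq {g h : ℝ → ℝ} (hg : Continuous g) (hh : Continuous h)
    (hgi : Integrable g) (hhi : Integrable h)
    (heq : ∀ s : ℝ, ∫ x : ℝ, (g x : ℂ) * Complex.exp (2 * Real.pi * s * Complex.I * x)
      = ∫ x : ℝ, (h x : ℂ) * Complex.exp (2 * Real.pi * s * Complex.I * x)) : g = h := by
  have hF : FourierTransform.fourier (fun x : ℝ => ((g x - h x : ℝ) : ℂ)) = fun _ : ℝ => (0 : ℂ) := by
    funext s
    rw [Real.fourier_real_eq_integral_exp_smul]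
    have hpt : ∀ x : ℝ, Complex.exp (((-2 * Real.pi * x * s : ℝ) : ℂ) * Complex.I)
        • ((g x - h x : ℝ) : ℂ)
        = (g x : ℂ) * Complex.exp (2 * Real.pi * (-s : ℝ) * Complex.I * x)
          - (h x : ℂ) * Complex.exp (2 * Real.pi * (-s : ℝ) * Complex.I * x) := by
      intro x
      rw [← sub_mul, smul_eq_mul, mul_comm]
      push_cast
      congr 2
      ring
    simp_rw [hpt]
    rw [integral_sub (integrable_mul_cexp_I hgi _) (integrable_mul_cexp_I hhi _), heq, sub_self]
  have hinv := Continuous.fourierInv_fourier_eq (f := fun x : ℝ => ((g x - h x : ℝ) : ℂ))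
    (Complex.continuous_ofReal.comp (hg.sub hh)) (hgi.sub hhi).ofReal
    (by rw [hF]; exact integrable_zero _ _ _)
  funext x
  have hx := congrFun hinv x
  rw [hF, Real.fourierInv_eq] at hx
  simp only [smul_zero, integral_zero] at hx
  have := Complex.ofReal_injective (hx.symm.trans Complex.ofReal_zero.symm)
  linarith

end CosineTransform

/-! ### Functions dominated by an even Hermite function -/

section Domination

open MeasureTheory ProbabilityTheory

/-- With `ρ = 1 + ‖z‖` this supplies both growth hypotheses of Hardy's theorem, with exponent 4. -/
theorem abs_hermiteQuadratic_le (c a b : ℝ) {u ρ : ℝ} (hρ : 1 ≤ ρ)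
    (hu : |u| ≤ 4 * Real.pi * ρ ^ 2) :
    |hermiteQuadratic c a b u| ≤ (|c| + 2 * |a| * (4 * Real.pi + 1)
      + |b| * (16 * Real.pi ^ 2 + 24 * Real.pi + 3)) * ρ ^ 4 := by
  have hπ := Real.pi_pos
  have h2 : 1 ≤ ρ ^ 2 := one_le_pow₀ hρ
  have h24 : ρ ^ 2 ≤ ρ ^ 4 := pow_le_pow_right₀ hρ (by norm_num)
  have h1 : |u - 1| ≤ (4 * Real.pi + 1) * ρ ^ 4 := by
    have := abs_sub u 1
    rw [abs_one] at this
    nlinarith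
  have h3 : |u ^ 2 - 6 * u + 3| ≤ (16 * Real.pi ^ 2 + 24 * Real.pi + 3) * ρ ^ 4 := by
    have hu2 : u ^ 2 ≤ 16 * Real.pi ^ 2 * ρ ^ 4 := by
      have := pow_le_pow_left₀ (abs_nonneg u) hu 2
      rw [sq_abs] at this
      linarith
    have hu3 : |u| ≤ 4 * Real.pi * ρ ^ 4 := by nlinarith
    rw [abs_le] at hu3 ⊢
    constructor <;> nlinarith
  calc |hermiteQuadratic c a b u| ≤ |c| + 2 * |a| * |u - 1| + |b| * |u ^ 2 - 6 * u + 3| := by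
        unfold hermiteQuadratic
        refine (abs_add_le _ _).trans (add_le_add ((abs_add_le _ _).trans_eq ?_) (abs_mul _ _).le)
        rw [abs_mul, abs_mul, abs_two]
    _ ≤ |c| * ρ ^ 4 + 2 * |a| * ((4 * Real.pi + 1) * ρ ^ 4)
        + |b| * ((16 * Real.pi ^ 2 + 24 * Real.pi + 3) * ρ ^ 4) := by
        gcongr
        exact le_mul_of_one_le_right (abs_nonneg c) (h2.trans h24)
    _ = _ := by ring

variable {g : ℝ → ℝ}

/-- The bilateral Laplace transform of a nonnegative function with all exponential moments is
entire. -/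
theorem differentiable_integral_mul_cexp (hg : Measurable g) (hg0 : ∀ x, 0 ≤ g x)
    (hint : ∀ t : ℝ, Integrable fun x => g x * Real.exp (t * x)) :
    Differentiable ℂ fun z : ℂ => ∫ x : ℝ, (g x : ℂ) * Complex.exp (z * x) := by
  set μ : Measure ℝ := volume.withDensity fun x => ENNReal.ofReal (g x) with hμ
  have hmeas : Measurable fun x => ENNReal.ofReal (g x) := hg.ennreal_ofReal
  have hset : integrableExpSet id μ = Set.univ := by
    rw [Set.eq_univ_iff_forall]
    intro t
    change Integrable (fun x => Real.exp (t * id x)) μ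
    rw [hμ, integrable_withDensity_iff_integrable_smul' hmeas (by simp)]
    refine (hint t).congr (.of_forall fun x => ?_)
    simp [ENNReal.toReal_ofReal (hg0 x)]
  have hmgf : (fun z : ℂ => ∫ x : ℝ, (g x : ℂ) * Complex.exp (z * x)) = complexMGF id μ := by
    funext z
    rw [complexMGF, hμ, integral_withDensity_eq_integral_toReal_smul hmeas (by simp)]
    refine integral_congr_ae (.of_forall fun x => ?_)
    simp [ENNReal.toReal_ofReal (hg0 x)]
  rw [hmgf]
  intro z
  exact (hasDerivAt_complexMGF (by rw [hset]; simp)).differentiableAt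

/-- A positive positive definite function that is dominated by an even Hermite function of degree
at most four, in the order of the cone, is itself such a Hermite function. -/
theorem PosPosDef.eq_evenHermite_of_sub_mem {c a b : ℝ} (hg : g ∈ PosPosDef)
    (hh : evenHermite c a b - g ∈ PosPosDef) : ∃ c' a' b', g = evenHermite c' a' b' := by
  have hπ := Real.pi_pos
  have hcont := PosPosDef.continuous hg
  have heven := PosPosDef.even hg
  have hle : ∀ x, g x ≤ evenHermite c a b x := fun x => by
    have := hh.2 x
    rw [Pi.sub_apply] at this
    linarith
  have hexpint : ∀ t : ℝ, Integrable fun x => evenHermite c a b x * Real.exp (t * x) := by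
    intro t
    have := (integrable_evenHermite_mul_cexp c a b t).re
    refine this.congr (.of_forall fun x => ?_)
    simp only [RCLike.re_to_complex]
    rw [Complex.re_ofReal_mul, ← Complex.ofReal_mul, Complex.exp_ofReal_re]
  have hgexp : ∀ t : ℝ, Integrable fun x => g x * Real.exp (t * x) := by
    intro t
    refine (hexpint t).mono (Continuous.aestronglyMeasurable (by fun_prop)) (.of_forall fun x => ?_)
    rw [norm_mul, norm_mul, Real.norm_of_nonneg (hg.2 x),
      Real.norm_of_nonneg ((hg.2 x).trans (hle x))]
    gcongr
    exact hle x
  have hgint : Integrable g := by simpa using hgexp 0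
  have hhint : Integrable (evenHermite c a b - g) := (integrable_evenHermite c a b).sub hgint
  set γ : ℝ → ℝ := fun s => ∫ x, g x * Real.cos (2 * Real.pi * s * x) with hγ
  have hγ0 : ∀ s, 0 ≤ γ s := fun s => PosPosDef.integral_mul_cos_nonneg hg hgint _
  have hγle : ∀ s, γ s ≤ evenHermite c (-a) b s := by
    intro s
    have h := PosPosDef.integral_mul_cos_nonneg hh hhint (2 * Real.pi * s)
    have hi : ∀ {k : ℝ → ℝ}, Integrable k →
        Integrable fun x => k x * Real.cos (2 * Real.pi * s * x) := fun hk =>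
      hk.mul_bdd (c := 1) (Continuous.aestronglyMeasurable (by fun_prop))
        (.of_forall fun x => Real.abs_cos_le_one _)
    simp only [Pi.sub_apply, sub_mul] at h
    rw [integral_sub (hi (integrable_evenHermite c a b)) (hi hgint),
      integral_evenHermite_mul_cos] at h
    linarith
  have hγeven : ∀ s, γ (-s) = γ s := by
    intro s
    simp only [hγ, mul_neg, neg_mul, Real.cos_neg]
  set G : ℂ → ℂ := fun z => ∫ x : ℝ, (g x : ℂ) * Complex.exp (z * x) with hG
  have hGd : Differentiable ℂ G :=
    differentiable_integral_mul_cexp hcont.measurable hg.2 hgexp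
  have hGγ : ∀ s : ℝ, G (2 * Real.pi * s * Complex.I) = (γ s : ℂ) :=
    integral_mul_cexp_I_eq_cos heven hgint
  have hGbound : ∀ z : ℂ, ‖G z‖ ≤ hermiteQuadratic c (-a) b (-(z.re ^ 2 / Real.pi))
      * Real.exp (z.re ^ 2 / (4 * Real.pi)) := by
    intro z
    calc ‖G z‖ ≤ ∫ x : ℝ, ‖(g x : ℂ) * Complex.exp (z * x)‖ := norm_integral_le_integral_norm _
      _ = ∫ x : ℝ, g x * Real.exp (z.re * x) := by
          refine integral_congr_ae (.of_forall fun x => ?_)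
          simp [Complex.norm_exp, abs_of_nonneg (hg.2 x)]
      _ ≤ ∫ x : ℝ, evenHermite c a b x * Real.exp (z.re * x) := by
          refine integral_mono (hgexp _) (hexpint _) fun x => ?_
          exact mul_le_mul_of_nonneg_right (hle x) (Real.exp_pos _).le
      _ = _ := by
          rw [integral_evenHermite_mul_exp, hermiteQuadratic]
          ring
  set K : ℝ := |c| + 2 * |-a| * (4 * Real.pi + 1)
      + |b| * (16 * Real.pi ^ 2 + 24 * Real.pi + 3) with hK
  have hquad : ∀ (z : ℂ) (u : ℝ), |u| ≤ 4 * Real.pi * ‖z‖ ^ 2 →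
      hermiteQuadratic c (-a) b u ≤ K * (1 + ‖z‖) ^ 4 := by
    intro z u hu
    refine (le_abs_self _).trans (abs_hermiteQuadratic_le c (-a) b (by simp) (hu.trans ?_))
    gcongr
    simp
  -- On the imaginary axis `G` carries the Fourier transform `γ`, so `F` extends `γ(s) e^{πs²}`. The
  -- bound on `G` costs `e^{π im(z)²}`, while `e^{πz²}` has modulus `e^{π(re(z)² - im(z)²)}`; only
  -- `e^{π re(z)²}` survives.
  let F : ℂ → ℂ := fun z => G (2 * Real.pi * z * Complex.I) * Complex.exp (Real.pi * z ^ 2)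
  have hFd : Differentiable ℂ F := by
    refine Differentiable.mul (hGd.comp ?_) ?_ <;> fun_prop
  have hFexp : ∀ z : ℂ, ‖F z‖ ≤ K * (1 + ‖z‖) ^ 4 * Real.exp (Real.pi * z.re ^ 2) := by
    intro z
    have hre : (2 * Real.pi * z * Complex.I).re = -(2 * Real.pi * z.im) := by simp
    have h1 := hGbound (2 * Real.pi * z * Complex.I)
    rw [hre] at h1
    have h2 : ‖Complex.exp (Real.pi * z ^ 2)‖
        = Real.exp (Real.pi * z.re ^ 2 - Real.pi * z.im ^ 2) := by
      rw [Complex.norm_exp, Complex.re_ofReal_mul]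
      congr 1
      simp [sq]
      ring
    have h3 : (-(2 * Real.pi * z.im)) ^ 2 / (4 * Real.pi) = Real.pi * z.im ^ 2 := by
      field_simp; ring
    have h4 : -((-(2 * Real.pi * z.im)) ^ 2 / Real.pi) = -(4 * Real.pi * z.im ^ 2) := by
      field_simp; ring
    rw [h3, h4] at h1
    have h5 : hermiteQuadratic c (-a) b (-(4 * Real.pi * z.im ^ 2)) ≤ K * (1 + ‖z‖) ^ 4 := by
      refine hquad z _ ?_
      rw [abs_neg, abs_of_nonneg (by positivity)]
      gcongr 4 * Real.pi * ?_
      rw [← sq_abs]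
      exact pow_le_pow_left₀ (abs_nonneg _) (Complex.abs_im_le_norm z) 2
    calc ‖F z‖ = ‖G (2 * Real.pi * z * Complex.I)‖
          * Real.exp (Real.pi * z.re ^ 2 - Real.pi * z.im ^ 2) := by rw [norm_mul, h2]
      _ ≤ K * (1 + ‖z‖) ^ 4 * Real.exp (Real.pi * z.im ^ 2)
          * Real.exp (Real.pi * z.re ^ 2 - Real.pi * z.im ^ 2) := by
          gcongr
          exact h1.trans (mul_le_mul_of_nonneg_right h5 (Real.exp_pos _).le)
      _ = _ := by
          rw [mul_assoc, ← Real.exp_add]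
          congr 2
          ring
  have hFγ : ∀ s : ℝ, F s = ((γ s * Real.exp (Real.pi * s ^ 2) : ℝ) : ℂ) := by
    intro s
    simp only [F]
    rw [hGγ]
    push_cast
    rfl
  -- Here the order of the cone enters a second time, through the bound on the transform rather than
  -- on `g`.
  have hFreal : ∀ s : ℝ, ‖F s‖ ≤ K * (1 + ‖(s : ℂ)‖) ^ 4 := by
    intro s
    rw [hFγ, Complex.norm_real, Real.norm_of_nonneg (mul_nonneg (hγ0 s) (Real.exp_pos _).le)]
    refine (mul_le_mul_of_nonneg_right (hγle s) (Real.exp_pos _).le).trans ?_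
    rw [evenHermite, mul_assoc, ← Real.exp_add]
    simp only [neg_mul, neg_add_cancel, Real.exp_zero, mul_one]
    refine hquad s _ ?_
    rw [Complex.norm_real, Real.norm_eq_abs, sq_abs, abs_of_nonneg (by positivity)]
  obtain ⟨p, hp⟩ := eq_sum_of_exp_growth_of_real_line (n := 4) hFd hπ (by positivity) hFexp hFreal
  set r : ℕ → ℝ := fun k => (p k).re with hr
  have hpoly : ∀ s : ℝ, γ s * Real.exp (Real.pi * s ^ 2)
      = r 0 + r 1 * s + r 2 * s ^ 2 + r 3 * s ^ 3 + r 4 * s ^ 4 := by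
    intro s
    have h := congrArg Complex.re (hp s)
    rw [hFγ, Complex.ofReal_re, Complex.re_sum] at h
    rw [h]
    simp only [← Complex.ofReal_pow, Complex.re_mul_ofReal, Finset.sum_range_succ,
      Finset.sum_range_zero, hr]
    ring
  -- Evenness of `γ` removes the odd coefficients.
  have hpoly' : ∀ s : ℝ, γ s * Real.exp (Real.pi * s ^ 2) = r 0 + r 2 * s ^ 2 + r 4 * s ^ 4 := by
    intro s
    have h1 := hpoly s
    have h2 := hpoly (-s)
    rw [hγeven, neg_sq] at h2
    linarith
  -- Coefficients are matched in `u = 4πs²`; `a'` carries a minus sign because `γ` is the transform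
  -- of the function sought.
  set b' := r 4 / (16 * Real.pi ^ 2) with hb'
  set a' := -((r 2 + 24 * Real.pi * b') / (8 * Real.pi)) with ha'
  set c' := r 0 - 2 * a' - 3 * b' with hc'
  have hγeq : ∀ s, γ s = evenHermite c' (-a') b' s := by
    intro s
    have h4 : r 4 = 16 * Real.pi ^ 2 * b' := by rw [hb']; field_simp
    have h2 : r 2 = -(8 * Real.pi * a') - 24 * Real.pi * b' := by rw [ha']; field_simp; ring
    have h0 : r 0 = c' + 2 * a' + 3 * b' := by rw [hc']; ring
    have h := hpoly' s
    rw [evenHermite, neg_mul, Real.exp_neg, ← div_eq_mul_inv, eq_div_iff (Real.exp_ne_zero _), h,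
      h4, h2, h0, hermiteQuadratic]
    ring
  refine ⟨c', a', b', eq_of_integral_mul_cexp_I_eq hcont (continuous_evenHermite _ _ _) hgint
    (integrable_evenHermite _ _ _) fun s => ?_⟩
  rw [integral_evenHermite_mul_cexp_I, integral_mul_cexp_I_eq_cos heven hgint, ← hγeq]

end Domination

/-! ### Geometry of the region -/

section Region

/-- Expanding the squares cancels the constant `1/8`. The factor `1 * b` matches the homogeneous
inequality at `c = 1`. -/
theorem mem_regionD_iff_quadratic {a b : ℝ} :
    (a, b) ∈ regionD ↔ a ^ 2 + 4 * |a| * b + 6 * b ^ 2 ≤ 1 * b := by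
  simp only [regionD, Set.mem_ofPred_eq]
  constructor
  · rintro (⟨h1, h2⟩ | ⟨h1, h2⟩)
    · rw [abs_of_nonneg h1]; nlinarith
    · rw [abs_of_nonpos h1]; nlinarith
  · intro h
    rcases le_total 0 a with h1 | h1
    · rw [abs_of_nonneg h1] at h
      exact Or.inl ⟨h1, by nlinarith⟩
    · rw [abs_of_nonpos h1] at h
      exact Or.inr ⟨h1, by nlinarith⟩

theorem regionD_eq_abs :
    regionD = {p | (|p.1| + 2 * p.2) ^ 2 + 2 * (p.2 - 1 / 4) ^ 2 ≤ 1 / 8} := by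
  ext ⟨a, b⟩
  rw [mem_regionD_iff_quadratic]
  simp only [Set.mem_ofPred_eq]
  have := sq_abs a
  constructor <;> intro h <;> nlinarith

/-- Replacing `|a|` by `± a` in the defining inequality of the cone. -/
theorem quadratic_le_of_abs {c a b : ℝ} (hc : 0 ≤ c)
    (h : a ^ 2 + 4 * |a| * b + 6 * b ^ 2 ≤ c * b) :
    a ^ 2 + 4 * a * b + 6 * b ^ 2 ≤ c * b ∧ a ^ 2 - 4 * a * b + 6 * b ^ 2 ≤ c * b := by
  have hb : 0 ≤ b := by
    by_contra! hb
    have := sq_abs a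
    nlinarith [sq_nonneg (|a| + 2 * b), mul_pos_of_neg_of_neg hb hb]
  have h1 := mul_le_mul_of_nonneg_right (le_abs_self a) hb
  have h2 := mul_le_mul_of_nonneg_right (neg_le_abs a) hb
  constructor <;> linarith

theorem quadratic_abs_le {c a b : ℝ}
    (h1 : a ^ 2 + 4 * a * b + 6 * b ^ 2 ≤ c * b) (h2 : a ^ 2 - 4 * a * b + 6 * b ^ 2 ≤ c * b) :
    a ^ 2 + 4 * |a| * b + 6 * b ^ 2 ≤ c * b := by
  rcases abs_choice a with h | h <;> rw [h] <;> linarith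

/-- The form equals `(a + 2b)² + 2b²`, hence is positive definite. -/
theorem eq_zero_of_quadratic_nonpos {a b : ℝ} (h : a ^ 2 + 4 * a * b + 6 * b ^ 2 ≤ 0) :
    a = 0 ∧ b = 0 := by
  have hb : b ^ 2 = 0 := le_antisymm (by nlinarith [sq_nonneg (a + 2 * b)]) (sq_nonneg b)
  have hb := pow_eq_zero_iff two_ne_zero |>.1 hb
  subst hb
  exact ⟨pow_eq_zero_iff two_ne_zero |>.1 (le_antisymm (by linarith) (sq_nonneg a)), rfl⟩

theorem regionD_eq_inter : regionD = ellipsePlus ∩ ellipseMinus := by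
  ext ⟨a, b⟩
  rw [mem_regionD_iff_quadratic]
  simp only [ellipsePlus, ellipseMinus, Set.mem_inter_iff, Set.mem_ofPred_eq]
  constructor
  · intro h
    obtain ⟨h1, h2⟩ := quadratic_le_of_abs zero_le_one h
    constructor <;> nlinarith
  · rintro ⟨h1, h2⟩
    exact quadratic_abs_le (by nlinarith) (by nlinarith)

theorem isClosed_regionD : IsClosed regionD := by
  rw [regionD_eq_abs]
  exact isClosed_le (by fun_prop) (by fun_prop)

theorem mem_interior_regionD {a b : ℝ} (h1 : a ^ 2 + 4 * a * b + 6 * b ^ 2 < b)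
    (h2 : a ^ 2 - 4 * a * b + 6 * b ^ 2 < b) : (a, b) ∈ interior regionD := by
  refine mem_interior.2 ⟨{p | p.1 ^ 2 + 4 * p.1 * p.2 + 6 * p.2 ^ 2 < p.2} ∩
    {p | p.1 ^ 2 - 4 * p.1 * p.2 + 6 * p.2 ^ 2 < p.2}, ?_, ?_, h1, h2⟩
  · rintro ⟨x, y⟩ ⟨h3, h4⟩
    simp only [Set.mem_ofPred_eq] at h3 h4
    exact mem_regionD_iff_quadratic.2 (quadratic_abs_le (by linarith) (by linarith))
  · exact (isOpen_lt (by fun_prop) (by fun_prop)).inter (isOpen_lt (by fun_prop) (by fun_prop))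

theorem hermiteFab_mem_posPosDef_iff {a b : ℝ} :
    hermiteFab a b ∈ PosPosDef ↔ (a, b) ∈ regionD := by
  rw [hermiteFab_eq_evenHermite, evenHermite_mem_posPosDef_iff, mem_regionD_iff_quadratic]
  exact and_iff_right zero_le_one

end Region

/-! ### Dilations and Hermite functions with general exponent -/

section Dilation

theorem PosPosDef.comp_mul {f : ℝ → ℝ} (hf : f ∈ PosPosDef) (r : ℝ) :
    (fun x => f (r * x)) ∈ PosPosDef := by
  refine ⟨⟨?_, fun n x c => ?_⟩, fun x => hf.2 _⟩
  · exact hf.1.1.comp (continuous_const.mul continuous_id)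
  · have := hf.1.2 n (fun j => r * x j) c
    simpa only [mul_sub] using this

theorem const_mul_evenHermite (k c a b x : ℝ) :
    k * evenHermite c a b x = evenHermite (k * c) (k * a) (k * b) x := by
  simp only [evenHermite, hermiteQuadratic]
  ring

theorem evenHermite_sqrt_mul {l : ℝ} (hl : 0 < l) (c a b x : ℝ) :
    evenHermite c a b (√(l / Real.pi) * x) =
      (c - 2 * a + 3 * b + (2 * a - 6 * b) * (4 * l) * x ^ 2 + 16 * l ^ 2 * b * x ^ 4)
        * Real.exp (-l * x ^ 2) := by
  have hπ := Real.pi_pos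
  have h : (√(l / Real.pi) * x) ^ 2 = l / Real.pi * x ^ 2 := by
    rw [mul_pow, Real.sq_sqrt (by positivity)]
  have h1 : 4 * Real.pi * (l / Real.pi * x ^ 2) = 4 * l * x ^ 2 := by field_simp
  have h2 : -Real.pi * (l / Real.pi * x ^ 2) = -l * x ^ 2 := by field_simp
  rw [evenHermite, h, h1, h2, hermiteQuadratic]
  ring

theorem eval_eq_of_eval_neg {P : Polynomial ℝ} (hP : P.natDegree ≤ 4)
    (heven : ∀ x, P.eval (-x) = P.eval x) (x : ℝ) :
    P.eval x = P.coeff 0 + P.coeff 2 * x ^ 2 + P.coeff 4 * x ^ 4 := by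
  have h : ∀ y, P.eval y = P.coeff 0 + P.coeff 1 * y + P.coeff 2 * y ^ 2 + P.coeff 3 * y ^ 3
      + P.coeff 4 * y ^ 4 := by
    intro y
    rw [Polynomial.eval_eq_sum_range' (Nat.lt_succ_of_le hP)]
    simp [Finset.sum_range_succ]
  have h1 := h x
  have h2 := h (-x)
  rw [heven] at h2
  linarith

/-- A nonzero positive positive definite Hermite function of degree at most four is a dilation of
a multiple of some `f_{a,b}`. -/
theorem exists_eq_hermiteFab {l : ℝ} (hl : 0 < l) {P : Polynomial ℝ} (hP0 : P ≠ 0)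
    (hP : P.natDegree ≤ 4) (hf : (fun x => P.eval x * Real.exp (-l * x ^ 2)) ∈ PosPosDef) :
    ∃ c a b : ℝ, 0 < c ∧ (a, b) ∈ regionD ∧ P.coeff 4 = 16 * l ^ 2 * (c * b) ∧
      (fun x => P.eval x * Real.exp (-l * x ^ 2))
        = fun x => c * hermiteFab a b (√(l / Real.pi) * x) := by
  have hπ := Real.pi_pos
  have heven : ∀ x, P.eval (-x) = P.eval x := by
    intro x
    have := PosPosDef.even hf x
    rw [neg_sq] at this
    exact mul_right_cancel₀ (Real.exp_ne_zero _) this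
  -- These values solve the coefficient equations read off from `evenHermite_sqrt_mul`.
  set B := P.coeff 4 / (16 * l ^ 2) with hB
  set A := (P.coeff 2 / (4 * l) + 6 * B) / 2 with hA
  set C := P.coeff 0 + 2 * A - 3 * B with hC
  have h4 : P.coeff 4 = 16 * l ^ 2 * B := by rw [hB]; field_simp
  have h2 : P.coeff 2 = (2 * A - 6 * B) * (4 * l) := by rw [hA]; field_simp; ring
  have h0 : P.coeff 0 = C - 2 * A + 3 * B := by rw [hC]; ring
  have hfeq : (fun x => P.eval x * Real.exp (-l * x ^ 2))
      = fun x => evenHermite C A B (√(l / Real.pi) * x) := by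
    funext x
    rw [eval_eq_of_eval_neg hP heven, evenHermite_sqrt_mul hl, h0, h2, h4]
  have hmem : evenHermite C A B ∈ PosPosDef := by
    rw [hfeq] at hf
    have := PosPosDef.comp_mul hf (√(l / Real.pi))⁻¹
    have hr : √(l / Real.pi) ≠ 0 := by positivity
    simpa [hr] using this
  obtain ⟨hC0, hineq⟩ := evenHermite_mem_posPosDef_iff.1 hmem
  -- The section `C = 0` of the cone is the origin alone, which would make `P` vanish.
  have hCpos : 0 < C := by
    refine hC0.lt_of_ne' fun hzero => hP0 ?_
    obtain ⟨hA0, hB0⟩ := eq_zero_of_quadratic_nonpos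
      ((quadratic_le_of_abs hC0 hineq).1.trans_eq (by rw [hzero, zero_mul]))
    refine Polynomial.funext fun x => ?_
    rw [eval_eq_of_eval_neg hP heven, h0, h2, h4, hzero, hA0, hB0]
    simp
  have hAC : C * (A / C) = A := by field_simp
  have hBC : C * (B / C) = B := by field_simp
  refine ⟨C, A / C, B / C, hCpos, ?_, by rw [hBC, h4], ?_⟩
  · rw [mem_regionD_iff_quadratic, abs_div, abs_of_pos hCpos]
    have : (A / C) ^ 2 + 4 * (|A| / C) * (B / C) + 6 * (B / C) ^ 2
        = (A ^ 2 + 4 * |A| * B + 6 * B ^ 2) / C ^ 2 := by field_simp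
    rw [this, div_le_iff₀ (by positivity)]
    refine hineq.trans_eq ?_
    field_simp
  · rw [hfeq]
    funext x
    rw [hermiteFab_eq_evenHermite, const_mul_evenHermite, hAC, hBC, mul_one]

open Polynomial in
theorem exists_polynomial_eq_hermiteFab {l : ℝ} (hl : 0 < l) (c a b : ℝ) :
    ∃ P : ℝ[X], P.natDegree ≤ 4 ∧ P.coeff 0 = c * (1 - 2 * a + 3 * b) ∧
      P.coeff 2 = c * (2 * a - 6 * b) * (4 * l) ∧ P.coeff 4 = 16 * l ^ 2 * (c * b) ∧
      (fun x => c * hermiteFab a b (√(l / Real.pi) * x))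
        = fun x => P.eval x * Real.exp (-l * x ^ 2) := by
  refine ⟨C (c * (1 - 2 * a + 3 * b)) + C (c * (2 * a - 6 * b) * (4 * l)) * X ^ 2
    + C (16 * l ^ 2 * (c * b)) * X ^ 4, by compute_degree, ?_, ?_, ?_, ?_⟩
  iterate 3 simp only [coeff_add, coeff_C_mul, coeff_X_pow, coeff_C]; norm_num
  · funext x
    rw [hermiteFab_eq_evenHermite, evenHermite_sqrt_mul hl]
    simp only [eval_add, eval_mul, eval_C, eval_pow, eval_X]
    ring

theorem posPosDef_const_mul_hermiteFab {a b c : ℝ} (hc : 0 < c) (hab : (a, b) ∈ regionD) (r : ℝ) :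
    (fun x => c * hermiteFab a b (r * x)) ∈ PosPosDef := by
  have h : evenHermite (c * 1) (c * a) (c * b) ∈ PosPosDef := by
    rw [evenHermite_mem_posPosDef_iff, abs_mul, abs_of_pos hc]
    have := mul_le_mul_of_nonneg_left (mem_regionD_iff_quadratic.1 hab) (sq_nonneg c)
    exact ⟨by linarith, by linarith⟩
  have := PosPosDef.comp_mul h r
  simpa only [hermiteFab_eq_evenHermite, const_mul_evenHermite] using this

theorem setOf_posPosDef_hermiteFunctions_le_four {l : ℝ} (hl : 0 < l) :
    {f | f ∈ PosPosDef ∧ ∃ N ≤ 4, f ∈ hermiteFunctions N l} =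
      {f | ∃ c a b : ℝ, 0 < c ∧ (a, b) ∈ regionD ∧
        f = fun x => c * hermiteFab a b (√(l / Real.pi) * x)} := by
  ext f
  constructor
  · rintro ⟨hf, N, hN, P, hP, rfl⟩
    have hP0 : P ≠ 0 := by rintro rfl; simp at hP
    obtain ⟨c, a, b, hc, hab, -, heq⟩ := exists_eq_hermiteFab hl hP0
      ((Polynomial.natDegree_eq_of_degree_eq_some hP).trans_le hN) hf
    exact ⟨c, a, b, hc, hab, heq⟩
  · rintro ⟨c, a, b, hc, hab, rfl⟩
    refine ⟨posPosDef_const_mul_hermiteFab hc hab _, ?_⟩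
    obtain ⟨P, hP, h0, h2, h4, heq⟩ := exists_polynomial_eq_hermiteFab hl c a b
    refine ⟨P.natDegree, hP, P, Polynomial.degree_eq_natDegree ?_, heq⟩
    rintro rfl
    simp [hc.ne', hl.ne'] at h0 h2 h4
    linarith

theorem setOf_posPosDef_hermiteFunctions_four {l : ℝ} (hl : 0 < l) :
    {f | f ∈ PosPosDef ∧ f ∈ hermiteFunctions 4 l} =
      {f | ∃ c a b : ℝ, 0 < c ∧ (a, b) ∈ regionD ∧ (a, b) ≠ (0, 0) ∧
        f = fun x => c * hermiteFab a b (√(l / Real.pi) * x)} := by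
  ext f
  constructor
  · rintro ⟨hf, P, hP, rfl⟩
    have hP0 : P ≠ 0 := by rintro rfl; simp at hP
    have hdeg := Polynomial.natDegree_eq_of_degree_eq_some hP
    obtain ⟨c, a, b, hc, hab, h4, heq⟩ := exists_eq_hermiteFab hl hP0 hdeg.le hf
    refine ⟨c, a, b, hc, hab, fun h => hP0 ?_, heq⟩
    rw [(Prod.mk.inj h).2, mul_zero, mul_zero, ← hdeg] at h4
    exact Polynomial.leadingCoeff_eq_zero.1 h4
  · rintro ⟨c, a, b, hc, hab, hne, rfl⟩
    refine ⟨posPosDef_const_mul_hermiteFab hc hab _, ?_⟩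
    obtain ⟨P, hP, -, -, h4, heq⟩ := exists_polynomial_eq_hermiteFab hl c a b
    -- The region meets the line `b = 0` only at the origin, so elsewhere the quartic coefficient
    -- survives.
    have hb : b ≠ 0 := by
      rintro rfl
      have := mem_regionD_iff_quadratic.1 hab
      have ha : a = 0 := by nlinarith
      exact hne (by rw [ha])
    have h4' : P.coeff 4 ≠ 0 := by
      rw [h4]
      have := hl.ne'
      have := hc.ne'
      positivity
    exact ⟨P, Polynomial.degree_eq_of_le_of_coeff_ne_zero
      (Polynomial.degree_le_of_natDegree_le hP) h4', heq⟩

end Dilation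

/-! ### Extremal rays -/

section Extremality

theorem evenHermite_injective {c a b c' a' b' : ℝ}
    (h : evenHermite c a b = evenHermite c' a' b') : c = c' ∧ a = a' ∧ b = b' := by
  have hπ := Real.pi_pos
  have hq : ∀ u, 0 ≤ u → hermiteQuadratic c a b u = hermiteQuadratic c' a' b' u := by
    intro u hu
    have h1 := congrFun h √(u / (4 * Real.pi))
    have h2 : 4 * Real.pi * √(u / (4 * Real.pi)) ^ 2 = u := by
      rw [Real.sq_sqrt (by positivity)]
      field_simp
    have h3 := mul_right_cancel₀ (Real.exp_ne_zero _) h1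
    rwa [h2] at h3
  have h1 := hq 1 (by norm_num)
  have h3 := hq 3 (by norm_num)
  have h5 := hq 5 (by norm_num)
  simp only [hermiteQuadratic] at h1 h3 h5
  refine ⟨?_, ?_, ?_⟩ <;> linarith

theorem evenHermite_sub (c a b c' a' b' : ℝ) :
    evenHermite c a b - evenHermite c' a' b' = evenHermite (c - c') (a - a') (b - b') := by
  funext x
  simp only [Pi.sub_apply, evenHermite, hermiteQuadratic]
  ring

theorem smul_evenHermite (k c a b : ℝ) :
    k • evenHermite c a b = evenHermite (k * c) (k * a) (k * b) :=
  funext fun x => const_mul_evenHermite k c a b x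

/-- Strict convexity of the ellipse `a² + 4ab + 6b² ≤ b`, in homogeneous form. -/
theorem eq_mul_of_add_of_quadratic_le {a b c a₁ b₁ : ℝ} (hc0 : 0 ≤ c) (hc1 : c ≤ 1)
    (h1 : a₁ ^ 2 + 4 * a₁ * b₁ + 6 * b₁ ^ 2 ≤ c * b₁)
    (h2 : (a - a₁) ^ 2 + 4 * (a - a₁) * (b - b₁) + 6 * (b - b₁) ^ 2 ≤ (1 - c) * (b - b₁))
    (h : b ≤ a ^ 2 + 4 * a * b + 6 * b ^ 2) : a₁ = c * a ∧ b₁ = c * b := by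
  rcases hc0.eq_or_lt with rfl | hc0
  · rw [zero_mul] at h1
    simpa using eq_zero_of_quadratic_nonpos h1
  rcases hc1.eq_or_lt with rfl | hc1
  · rw [sub_self, zero_mul] at h2
    obtain ⟨h3, h4⟩ := eq_zero_of_quadratic_nonpos h2
    constructor <;> linarith
  -- For the form `Q = a² + 4ab + 6b²` and `p = (a, b)`, `p₁ = (a₁, b₁)`, one has `(1-c)Q(p₁) +
  -- cQ(p-p₁) - c(1-c)Q(p) = Q(p₁ - cp)`. The right-hand sides of the weighted inequalities cancel,
  -- so `Q(p₁ - cp) ≤ 0`.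
  have h3 := mul_le_mul_of_nonneg_left h1 (sub_pos.2 hc1).le
  have h4 := mul_le_mul_of_nonneg_left h2 hc0.le
  have h5 := mul_le_mul_of_nonneg_left h (mul_pos hc0 (sub_pos.2 hc1)).le
  obtain ⟨h6, h7⟩ := eq_zero_of_quadratic_nonpos (a := a₁ - c * a) (b := b₁ - c * b) (by linarith)
  constructor <;> linarith

theorem isExtremalRayGenerator_hermiteFab_of_mem_frontier {a b : ℝ}
    (hab : (a, b) ∈ frontier regionD) : IsExtremalRayGenerator (hermiteFab a b) := by
  rw [isClosed_regionD.frontier_eq] at hab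
  obtain ⟨hmem, hint⟩ := hab
  refine ⟨hermiteFab_mem_posPosDef_iff.2 hmem, ?_⟩
  rw [hermiteFab_eq_evenHermite]
  ext g
  constructor
  · rintro ⟨hg, h, hh, hgh⟩
    have hsub : evenHermite 1 a b - g = h := by rw [hgh, sub_sub_cancel]
    rw [← hsub] at hh
    obtain ⟨c, a₁, b₁, rfl⟩ := PosPosDef.eq_evenHermite_of_sub_mem hg hh
    rw [evenHermite_sub] at hh
    obtain ⟨hc0, hg'⟩ := evenHermite_mem_posPosDef_iff.1 hg
    obtain ⟨hc1, hh'⟩ := evenHermite_mem_posPosDef_iff.1 hh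
    obtain ⟨hg1, hg2⟩ := quadratic_le_of_abs hc0 hg'
    obtain ⟨hh1, hh2⟩ := quadratic_le_of_abs hc1 hh'
    have hc1 : c ≤ 1 := sub_nonneg.1 hc1
    have key : a₁ = c * a ∧ b₁ = c * b := by
      -- Were both ellipse inequalities strict, the point would be interior. One of them is
      -- therefore tight, and the mirror ellipse is reduced to the first by changing the sign of
      -- `a`.
      by_cases hq : b ≤ a ^ 2 + 4 * a * b + 6 * b ^ 2
      · exact eq_mul_of_add_of_quadratic_le hc0 hc1 hg1 hh1 hq
      · have hq' : b ≤ a ^ 2 - 4 * a * b + 6 * b ^ 2 := by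
          by_contra! hq'
          exact hint (mem_interior_regionD (not_le.1 hq) hq')
        obtain ⟨h3, h4⟩ := eq_mul_of_add_of_quadratic_le (a := -a) (b := b) (a₁ := -a₁) (b₁ := b₁)
          hc0 hc1 (by linarith) (by linarith) (by linarith)
        exact ⟨by linarith, h4⟩
    refine ⟨c, hc0, hc1, ?_⟩
    rw [smul_evenHermite, mul_one, key.1, key.2]
  · rintro ⟨t, ht0, ht1, rfl⟩
    have hscale : ∀ s : ℝ, 0 ≤ s → s • evenHermite 1 a b ∈ PosPosDef := by
      intro s hs
      rw [smul_evenHermite, evenHermite_mem_posPosDef_iff, abs_mul, abs_of_nonneg hs]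
      have := mul_le_mul_of_nonneg_left (mem_regionD_iff_quadratic.1 hmem) (sq_nonneg s)
      exact ⟨by linarith, by linarith⟩
    exact ⟨hscale t ht0, (1 - t) • evenHermite 1 a b, hscale _ (sub_nonneg.2 ht1), by
      rw [sub_smul, one_smul, sub_sub_cancel]⟩

/-- Here `f_{a,b}` is the sum of `f_{a+δ,b} / 2` and `f_{a-δ,b} / 2`, both in the cone for small
`δ`. Neither is a multiple of `f_{a,b}`: the `H₀` coefficient forces the factor `1/2`, and then the
`H₂` coefficients disagree. -/
theorem not_isExtremalRayGenerator_of_mem_interior {a b : ℝ} (hab : (a, b) ∈ interior regionD) :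
    ¬ IsExtremalRayGenerator (hermiteFab a b) := by
  rintro ⟨-, hext⟩
  obtain ⟨ε, hε, hball⟩ := Metric.mem_nhds_iff.1 (mem_interior_iff_mem_nhds.1 hab)
  have hmem : ∀ δ : ℝ, |δ| < ε → evenHermite (1 / 2) ((a + δ) / 2) (b / 2) ∈ PosPosDef := by
    intro δ hδ
    have h : (a + δ, b) ∈ regionD := hball (by simpa [Prod.dist_eq, Real.dist_eq, hε] using hδ)
    rw [evenHermite_mem_posPosDef_iff, abs_div, abs_two]
    have := mem_regionD_iff_quadratic.1 h
    exact ⟨by norm_num, by linarith⟩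
  have h1 := hmem (ε / 2) (by rw [abs_of_pos] <;> linarith)
  have h2 := hmem (-(ε / 2)) (by rw [abs_neg, abs_of_pos] <;> linarith)
  have hg : evenHermite (1 / 2) ((a + ε / 2) / 2) (b / 2) ∈ ppdInterval (hermiteFab a b) := by
    refine ⟨h1, _, h2, ?_⟩
    rw [hermiteFab_eq_evenHermite, evenHermite_sub]
    congr 1 <;> ring
  rw [hext] at hg
  obtain ⟨t, -, -, ht⟩ := hg
  rw [hermiteFab_eq_evenHermite, smul_evenHermite] at ht
  obtain ⟨h3, h4, -⟩ := evenHermite_injective ht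
  rw [mul_one] at h3
  rw [← h3] at h4
  linarith

end Extremality

theorem mainTheorem5 :
    -- the region `D` is the intersection of the two ellipses
    regionD = ellipsePlus ∩ ellipseMinus ∧
    regionD = {p | (|p.1| + 2 * p.2) ^ 2 + 2 * (p.2 - 1 / 4) ^ 2 ≤ 1 / 8} ∧
    -- `f_{a,b}` is positive positive definite exactly for `(a, b) ∈ D`
    (∀ a b : ℝ, hermiteFab a b ∈ PosPosDef ↔ (a, b) ∈ regionD) ∧
    -- all positive positive definite Hermite functions of degree 4, up to dilation and scaling
    (∀ l : ℝ, 0 < l →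
      {f | f ∈ PosPosDef ∧ f ∈ hermiteFunctions 4 l} =
        {f | ∃ c a b : ℝ, 0 < c ∧ (a, b) ∈ regionD ∧ (a, b) ≠ (0, 0) ∧
          f = fun x => c * hermiteFab a b (Real.sqrt (l / Real.pi) * x)}) ∧
    -- all nonzero positive positive definite Hermite functions of degree at most 4
    (∀ l : ℝ, 0 < l →
      {f | f ∈ PosPosDef ∧ ∃ N ≤ 4, f ∈ hermiteFunctions N l} =
        {f | ∃ c a b : ℝ, 0 < c ∧ (a, b) ∈ regionD ∧
          f = fun x => c * hermiteFab a b (Real.sqrt (l / Real.pi) * x)}) ∧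
    -- extremality
    (∀ a b : ℝ, IsExtremalRayGenerator (hermiteFab a b) ↔ (a, b) ∈ frontier regionD) := by
  refine ⟨regionD_eq_inter, regionD_eq_abs, fun a b => hermiteFab_mem_posPosDef_iff,
    fun l hl => setOf_posPosDef_hermiteFunctions_four hl,
    fun l hl => setOf_posPosDef_hermiteFunctions_le_four hl, fun a b => ⟨fun h => ?_,
      isExtremalRayGenerator_hermiteFab_of_mem_frontier⟩⟩
  rw [isClosed_regionD.frontier_eq]
  exact ⟨hermiteFab_mem_posPosDef_iff.1 h.1,
    fun hint => not_isExtremalRayGenerator_of_mem_interior hint h⟩
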